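/- Let $A$ be a regular two-dimensional local ring of prime characteristic $p>0$ with algebraically closed residue field $k$ and fraction field $K$. Let $L/K$ be a cyclic extension of degree $p$, and let $B$ be the integral closure of $A$ in $L$. Let $\mathfrak p_1,\dots,\mathfrak p_d$ be the primes $\mathfrak p$ of $A$ with $\dim A/\mathfrak p=1$ at which $L/K$ is ramified (i.e. over which some prime of $B$ has ramification index $>1$ or an inseparable residue field extension). For distinct such primes put $(F_{\mathfrak p}.F_{\mathfrak p'})=\dim_k A/(\mathfrak p+\mathfrak p')$, understood as the length of this $A$-module. Assume that the branch divisor is non-empty and strictly normal crossing: $1\le d\le 2$, the rings $A/\mathfrak p_i$ are regular, and $(F_{\mathfrak p_1}.F_{\mathfrak p_2})=1$ if $d=2$. Let $v_i$ be the normalized discrete valuation of $K$ attached to $\mathfrak p_i$. Let $U_A$ be the set of primes $\mathfrak p\ne\mathfrak p_1,\dots,\mathfrak p_d$ of $A$ such that $A/\mathfrak p$ is regular of dimension $1$. For $\mathfrak p\in U_A$ choose a prime $\mathfrak q$ of $B$ over $\mathfrak p$, and put $K(\mathfrak p)=\operatorname{Fr}(A/\mathfrak p)$, $L(\mathfrak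 q)=\operatorname{Fr}(B/\mathfrak q)$; the extension $L(\mathfrak q)/K(\mathfrak p)$ is Galois of degree $1$ or $p$. If its ramification index over the discrete valuation ring $A/\mathfrak p$ equals $p$, let $h_{\mathfrak p}(L/K)$ be the largest $i$ such that its $i$-th lower ramification group has order $p$; otherwise let $h_{\mathfrak p}(L/K)=0$. (This does not depend on $\mathfrak q$.) For $r\ge1$ let $T_r$ be the set of $\mathfrak p\in U_A$ with $(F_{\mathfrak p}.F_{\mathfrak p_1})=r$ and, if $d=2$, also $(F_{\mathfrak p}.F_{\mathfrak p_2})=1$. Then for every $r\ge1$ the supremum $$h_r(L/K)=\sup\{h_{\mathfrak p}(L/K)\mid \mathfrak p\in T_r\}$$ is finite. More explicitly, let $T$ (and $U$, if $d=2$) be generators of $\mathfrak p_1$ (and $\mathfrak p_2$). There is a generator $x$ of $L$ over $K$ with $x^p-x=a$, where $a\in A[T^{-1}]$ if $d=1$ and $a\in A[T^{-1},U^{-1}]$ if $d=2$; and for every such generator and every $r\ge1$, $$h_r(L/K)\le rm+n,$$ where $m=-v_1(a)$, and $n=-v_2(a)$ if $d=2$, $n=0$ if $d=1$. -/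

import Mathlib

/-! ### Lower ramification filtration over a discrete valuation ring -/

section LocalRamification

variable (R F E : Type*) [CommRing R] [Field F] [Field E] [Algebra R F] [Algebra F E]
  [Algebra R E] [IsScalarTower R F E]

/-- For `E / F` Galois, `F` the fraction field of a discrete valuation ring `R`, and `Q` a maximal
ideal of the integral closure `S` of `R` in `E`: the `i`-th lower ramification group
`G_i = {σ | σ x ≡ x mod Q ^ (i + 1) for all x ∈ S}`, for `i ≥ 0`. -/
noncomputable def lowerRamificationGroup (Q : Ideal (integralClosure R E)) (i : ℕ) :
    Subgroup (E ≃ₐ[F] E) :=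
  (Q ^ (i + 1)).inertia (E ≃ₐ[F] E)

/-- The only ramification jump of `E / F` if the ramification index `e(E / F)` is `p`, namely
the largest `i` such that `G_i` has order `p`; and `0` if `e(E / F) ≠ p`.
The largest `i` is taken as a supremum in `ℕ∞`, so that no value is assigned by convention if
the set of these `i` is unbounded. If the ramification index is `p = [E : F]`, there is only one
maximal ideal `Q`. -/
noncomputable def localJump (p : ℕ) : ℕ∞ :=
  ⨆ (Q : Ideal (integralClosure R E)) (_ : Q.IsMaximal) (_ : Q.ramificationIdx R = p)
    (i : ℕ) (_ : Nat.card (lowerRamificationGroup R F E Q i) = p), (i : ℕ∞)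

end LocalRamification

/-! ### Prime divisors and branch locus -/

section Divisors

variable (A : Type*) [CommRing A]

/-- `Spec₁ A`, the set of prime ideals `𝔭` with `dim (A / 𝔭) = 1`. -/
def specOne : Set (PrimeSpectrum A) :=
  {P | ringKrullDim (A ⧸ P.asIdeal) = 1}

variable {A}

/-- The intersection number `(F_𝔭 . F_𝔭')` of two prime divisors of a local ring `A`: the length
of `A / (𝔭 + 𝔭')`, i.e. its dimension over the residue field of `A`. -/
noncomputable def interNumber (P P' : PrimeSpectrum A) : ℕ∞ :=
  Module.length A (A ⧸ (P.asIdeal ⊔ P'.asIdeal))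

/-- The order of `a ∈ K = Fr A` at the principal prime `P = (t)` is `z`, i.e. `v_P(a) = z`
for the normalized discrete valuation with valuation ring `A_P`: one has `a = t ^ z * (x / y)`
with `x`, `y` outside `P`. -/
def HasOrderAt {K : Type*} [Field K] [Algebra A K] (P : PrimeSpectrum A) (a : K) (z : ℤ) : Prop :=
  ∃ t x y : A, P.asIdeal = Ideal.span {t} ∧ x ∉ P.asIdeal ∧ y ∉ P.asIdeal ∧
    a * algebraMap A K y = algebraMap A K t ^ z * algebraMap A K x

variable (A) in
/-- The branch primes of `L` over `A`: those `𝔭 ∈ Spec₁ A` over which some prime of the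
integral closure `B` of `A` in `L` is not unramified (i.e. has ramification index `> 1` or
inseparable residue field extension). -/
def branchPrimes (L : Type*) [Field L] [Algebra A L] : Set (PrimeSpectrum A) :=
  {P | P ∈ specOne A ∧ ¬ Algebra.IsUnramifiedIn (integralClosure A L) P.asIdeal}

/-- `P 0, …, P (d - 1)` is a listing, without repetition, of the branch primes of `L` over `A`,
and the branch divisor is nonzero and strictly normal crossing. -/
structure IsNormalCrossingBranch (L : Type*) [Field L] [Algebra A L] {d : ℕ}
    (P : Fin d → PrimeSpectrum A) : Prop where
  injective : Function.Injective P
  range_eq : Set.range P = branchPrimes A L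
  one_le : 1 ≤ d
  le_two : d ≤ 2
  regular : ∀ i, IsRegularLocalRing (A ⧸ (P i).asIdeal)
  transversal : ∀ i j, i ≠ j → interNumber (P i) (P j) = 1

/-- `U_A`: the primes `𝔭 ∈ Spec₁ A` with `A / 𝔭` regular, distinct from all the branch primes. -/
def regularNonbranch {d : ℕ} (P : Fin d → PrimeSpectrum A) : Set (PrimeSpectrum A) :=
  {Q | Q ∈ specOne A ∧ IsRegularLocalRing (A ⧸ Q.asIdeal) ∧ ∀ i, Q ≠ P i}

/-- `T_r`: the primes `𝔭 ∈ U_A` whose divisor has intersection number `r` with the first branch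
component, and `1` with the second one if there are two. -/
def tangencySet {d : ℕ} (P : Fin d → PrimeSpectrum A) (r : ℕ) : Set (PrimeSpectrum A) :=
  {Q | Q ∈ regularNonbranch P ∧
    ∀ i : Fin d, interNumber Q (P i) = if i.val = 0 then (r : ℕ∞) else 1}

end Divisors

/-! ### The jumps `h_𝔭(L/K)` and `h_r(L/K)` -/

section Jumps

variable {A : Type*} [CommRing A] (L : Type*) [Field L] [Algebra A L] (p : ℕ)

/-- The ramification jump of the extension `L(𝔮) / K(𝔭)` over the ring `A / 𝔭`, where
`𝔮` is a prime of the integral closure `B` of `A` in `L` over `𝔭`, and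
`K(𝔭) = Fr (A / 𝔭)`, `L(𝔮) = Fr (B / 𝔮)`. -/
noncomputable def residueJump (P : Ideal A) [P.IsPrime] (q : Ideal (integralClosure A L))
    [q.IsPrime] [q.LiesOver P] : ℕ∞ :=
  letI : Algebra (FractionRing (A ⧸ P)) (FractionRing (integralClosure A L ⧸ q)) :=
    FractionRing.liftAlgebra (A ⧸ P) (FractionRing (integralClosure A L ⧸ q))
  localJump (A ⧸ P) (FractionRing (A ⧸ P)) (FractionRing (integralClosure A L ⧸ q)) p

/-- `h_𝔭(L/K)`: the ramification jump of `L(𝔮) / K(𝔭)`; all the primes `𝔮` over `𝔭`, being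
conjugate, give the same value. -/
noncomputable def jumpAt (P : PrimeSpectrum A) : ℕ∞ :=
  ⨆ (q : Ideal (integralClosure A L)) (_ : q.IsPrime) (_ : q.LiesOver P.asIdeal),
    residueJump L p P.asIdeal q

/-- `h_r(L/K)`: the supremum of `h_𝔭(L/K)` over `𝔭 ∈ T_r`, as an element of `ℕ ∪ {∞}`. -/
noncomputable def genericJump {d : ℕ} (P : Fin d → PrimeSpectrum A) (r : ℕ) : ℕ∞ :=
  ⨆ Q ∈ tangencySet P r, jumpAt L p Q

end Jumps

/-- `x` is an Artin–Schreier generator of `L / K`, with `x ^ p - x = a`, where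
`a ∈ A[t i⁻¹ : i]` for generators `t i` of the branch primes `P i`, i.e. the poles of `a`
are among the branch components; and `m i = - v_i(a)` is the order of the pole of `a`
along the component `P i`. -/
structure IsArtinSchreierGenerator {A K L : Type*} [CommRing A] [Field K] [Field L] [Algebra A K]
    [Algebra K L] (p : ℕ) {d : ℕ} (P : Fin d → PrimeSpectrum A) (x : L) (a : K)
    (m : Fin d → ℕ) : Prop where
  equation : x ^ p - x = algebraMap K L a
  generates : IntermediateField.adjoin K {x} = ⊤
  poles : ∃ t : Fin d → A, (∀ i, (P i).asIdeal = Ideal.span {t i}) ∧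
    a ∈ Algebra.adjoin A (Set.range fun i => (algebraMap A K (t i))⁻¹)
  order : ∀ i, HasOrderAt (P i) a (-(m i : ℤ))

/-! ### Two-dimensional regular local rings -/

section RegularSurface

open IsLocalRing

/-! The bound comes from restricting one Artin–Schreier equation to each curve. Since the quotient
of `A` by a branch prime is a discrete valuation ring, `A` is factorial, so `a = c / f` with `f = ∏
t i ^ m i` (`exists_mul_prod_pow_eq`). Then `y = f x` is integral and satisfies `y ^ p = f ^ (p - 1)
* (y + c)`. For `Q ∈ T_r` no `t i` lies in `Q`, hence neither does `f`. The discriminant of this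
equation is a power of `f` up to sign, so the class of `y` still generates the residue extension
over `Q` (`adjoin_residue_eq_top`).

Over the discrete valuation ring `A / Q`, such an equation bounds the jump by the order of `f`
(`le_of_mem_inertia_pow`, `localJump_le_of_pow_eq`): a nontrivial conjugate of `y` differs from `y`
by an element `w` with `w ^ (p - 1) = f ^ (p - 1)`, which fixes the order of `w`. The order of `f`
is at most the sum of the `m i` times the intersection numbers of `Q` with the branch components
(`addVal_le_interNumber`), that is `r m + n`, uniformly in `Q`.

For existence of a generator, inertia is trivial over every prime of dimension one off the branch
locus, so the trace ideal of the integral closure contains a power of `∏ t i`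
(`exists_trace_eq_pow`). Dividing gives an element of trace `1` with poles only along the branch
locus, and additive Hilbert 90 makes from it a generator with the same poles. As the residue field
is infinite, adding an element of `A` to the generator ensures that `a` vanishes along no branch
component, so that each `m i` is a natural number. Finiteness follows from this generator and the
bound. -/

theorem IsRegularLocalRing.exists_maximalIdeal_eq_span_pair {A : Type*} [CommRing A]
    [IsRegularLocalRing A] (hdim : ringKrullDim A = 2) :
    ∃ x y : A, maximalIdeal A = Ideal.span {x, y} := by
  have h : (maximalIdeal A).spanFinrank = 2 := by
    have := IsRegularLocalRing.spanFinrank_maximalIdeal (R := A)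
    rw [hdim] at this
    exact_mod_cast this
  have hfg : (maximalIdeal A).FG := IsNoetherian.noetherian _
  have hc := Submodule.FG.generators_ncard hfg
  rw [h, Set.ncard_eq_two] at hc
  obtain ⟨x, y, -, hxy⟩ := hc
  exact ⟨x, y, by rw [← hxy]; exact (Submodule.span_generators _).symm⟩

theorem IsRegularLocalRing.isDiscreteValuationRing {R : Type*} [CommRing R] [IsDomain R]
    [IsRegularLocalRing R] (hdim : ringKrullDim R = 1) : IsDiscreteValuationRing R := by
  have hfin := (IsRegularLocalRing.iff_finrank_cotangentSpace R).mp inferInstance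
  rw [hdim] at hfin
  have hfin' : Module.finrank (ResidueField R) (CotangentSpace R) ≤ 1 := by
    have : Module.finrank (ResidueField R) (CotangentSpace R) = 1 := by exact_mod_cast hfin
    exact this.le
  have : IsPrincipalIdealRing R :=
    ((tfae_of_isNoetherianRing_of_isLocalRing_of_isDomain R).out 5 0).mp hfin'
  refine { not_a_field' := fun h ↦ ?_ }
  have := ringKrullDim_eq_zero_of_isField ((isField_iff_maximalIdeal_eq).mpr h)
  rw [hdim] at this
  exact one_ne_zero this

/-- In a Noetherian local ring with maximal ideal `(x, t)`, an ideal `I` containing `t` but no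
power of `x` equals `(t)`. -/
theorem Ideal.eq_span_singleton_of_pow_notMem {A : Type*} [CommRing A] [IsLocalRing A]
    [IsNoetherianRing A] {x t : A} (hm : maximalIdeal A = Ideal.span {x, t}) {I : Ideal A}
    (ht : t ∈ I) (hx : ∀ n : ℕ, x ^ n ∉ I) : I = Ideal.span {t} := by
  refine le_antisymm (fun a ha ↦ ?_) ((Ideal.span_singleton_le_iff_mem _).mpr ht)
  -- The coefficient `c` is never a unit, since otherwise `x ^ n ∈ I`; so it can be expanded again
  -- in `x` and `t`. Hence `a` lies in every power of the maximal ideal modulo `t`, and Krull's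
  -- intersection theorem applies.
  have key : ∀ n : ℕ, ∃ c d : A, a = c * x ^ n + d * t := by
    intro n
    induction n with
    | zero => exact ⟨a, 0, by simp⟩
    | succ n ih =>
      obtain ⟨c, d, h⟩ := ih
      have hc : c ∈ maximalIdeal A := by
        by_contra hc
        rw [mem_maximalIdeal, mem_nonunits_iff, not_not] at hc
        apply hx n
        have h1 : c * x ^ n ∈ I := by
          have : c * x ^ n = a - d * t := by rw [h]; ring
          rw [this]
          exact I.sub_mem ha (I.mul_mem_left _ ht)
        exact (Ideal.unit_mul_mem_iff_mem I hc).mp h1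
      rw [hm, Ideal.mem_span_pair] at hc
      obtain ⟨u, v, hc⟩ := hc
      exact ⟨u, v * x ^ n + d, by rw [h, ← hc]; ring⟩
  have hne : Ideal.span {t} ≠ ⊤ := by
    intro h
    apply hx 0
    have : (⊤ : Ideal A) ≤ I := h ▸ (Ideal.span_singleton_le_iff_mem _).mpr ht
    exact this trivial
  have : Nontrivial (A ⧸ Ideal.span {t}) := Ideal.Quotient.nontrivial_iff.mpr hne
  have : IsLocalRing (A ⧸ Ideal.span {t}) :=
    IsLocalRing.of_surjective' (Ideal.Quotient.mk _) Ideal.Quotient.mk_surjective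
  rw [← Ideal.Quotient.eq_zero_iff_mem, ← Ideal.mem_bot,
    ← Ideal.iInf_pow_eq_bot_of_isLocalRing (maximalIdeal (A ⧸ Ideal.span {t}))
      Ideal.IsPrime.ne_top', Ideal.mem_iInf]
  intro n
  obtain ⟨c, d, h⟩ := key n
  have hx' : Ideal.Quotient.mk (Ideal.span {t}) x ∈ maximalIdeal (A ⧸ Ideal.span {t}) := by
    rw [mem_maximalIdeal, mem_nonunits_iff]
    intro hu
    obtain ⟨y, hy⟩ := hu.exists_right_inv
    obtain ⟨y, rfl⟩ := Ideal.Quotient.mk_surjective y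
    rw [← map_mul, ← map_one (Ideal.Quotient.mk _), Ideal.Quotient.eq,
      Ideal.mem_span_singleton'] at hy
    obtain ⟨z, hz⟩ := hy
    have hxm : x ∈ maximalIdeal A := by rw [hm]; exact Ideal.subset_span (by simp)
    have htm : t ∈ maximalIdeal A := by rw [hm]; exact Ideal.subset_span (by simp)
    have h1 : (1 : A) ∈ maximalIdeal A := by
      rw [show (1 : A) = x * y - z * t by rw [hz]; ring]
      exact Ideal.sub_mem _ (Ideal.mul_mem_right _ _ hxm) (Ideal.mul_mem_left _ _ htm)
    exact (Ideal.ne_top_iff_one _).mp Ideal.IsPrime.ne_top' h1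
  have ht0 : Ideal.Quotient.mk (Ideal.span {t}) t = 0 :=
    Ideal.Quotient.eq_zero_iff_mem.mpr (Ideal.mem_span_singleton_self t)
  rw [h, map_add, map_mul, map_mul, map_pow, ht0, mul_zero, add_zero]
  exact Ideal.mul_mem_left _ _ (Ideal.pow_mem_pow hx' n)

/-- In the valuation ring `A ⧸ P` one of two generators `x`, `y` of the maximal ideal divides the
other, say `y ≡ x * c`. Then `y - x * c` lies in `P` and can replace `y` as a generator, while no
power of `x` lies in `P`. -/
theorem IsRegularLocalRing.exists_eq_span_singleton {A : Type*} [CommRing A]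
    [IsRegularLocalRing A] (hdim : ringKrullDim A = 2) {P : Ideal A} [P.IsPrime]
    [IsRegularLocalRing (A ⧸ P)] (hP : ringKrullDim (A ⧸ P) = 1) :
    ∃ t : A, P = Ideal.span {t} := by
  have := IsRegularLocalRing.isDiscreteValuationRing hP
  have hPm : P ≠ maximalIdeal A := by
    rintro rfl
    have := ringKrullDim_eq_zero_of_isField
      ((Ideal.Quotient.maximal_ideal_iff_isField_quotient (maximalIdeal A)).mp inferInstance)
    rw [hP] at this
    exact one_ne_zero this
  have main : ∀ x y : A, maximalIdeal A = Ideal.span {x, y} →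
      Ideal.Quotient.mk P x ∣ Ideal.Quotient.mk P y → ∃ t : A, P = Ideal.span {t} := by
    rintro x y hm ⟨c, hc⟩
    obtain ⟨c, rfl⟩ := Ideal.Quotient.mk_surjective c
    have ht : y - x * c ∈ P := by
      rw [← Ideal.Quotient.eq_zero_iff_mem, map_sub, map_mul, hc, sub_self]
    have hm' : maximalIdeal A = Ideal.span {x, y - x * c} := by
      rw [hm, sub_eq_add_neg, ← mul_neg, mul_comm, Ideal.span_pair_add_mul_left]
    refine ⟨y - x * c, Ideal.eq_span_singleton_of_pow_notMem hm' ht fun n hn ↦ hPm ?_⟩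
    have hxP := ‹P.IsPrime›.mem_of_pow_mem n hn
    refine le_antisymm (le_maximalIdeal Ideal.IsPrime.ne_top') ?_
    rw [hm', Ideal.span_le]
    rintro z (rfl | rfl)
    exacts [hxP, ht]
  obtain ⟨x, y, hm⟩ := IsRegularLocalRing.exists_maximalIdeal_eq_span_pair hdim
  rcases ValuationRing.dvd_total (Ideal.Quotient.mk P x) (Ideal.Quotient.mk P y) with h | h
  · exact main x y hm h
  · exact main y x (by rw [hm, Set.pair_comm]) h

/-- A Noetherian local domain is factorial if it is a PID modulo some prime element. -/
theorem UniqueFactorizationMonoid.of_isPrincipalIdealRing_quotient {A : Type*} [CommRing A]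
    [IsDomain A] [IsLocalRing A] [IsNoetherianRing A] {t : A} (ht : Prime t)
    [IsPrincipalIdealRing (A ⧸ Ideal.span {t})] : UniqueFactorizationMonoid A := by
  rw [UniqueFactorizationMonoid.iff_exists_prime_mem_of_isPrime]
  intro P hP hPp
  by_cases htP : t ∈ P
  · exact ⟨t, htP, ht⟩
  obtain ⟨f, hf⟩ := (IsPrincipalIdealRing.principal
    (P.map (Ideal.Quotient.mk (Ideal.span {t})))).principal
  have hfm : f ∈ P.map (Ideal.Quotient.mk (Ideal.span {t})) := by
    rw [hf]; exact Submodule.mem_span_singleton_self f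
  obtain ⟨f, hfP, rfl⟩ := (Ideal.mem_map_iff_of_surjective _ Ideal.Quotient.mk_surjective).mp hfm
  -- Nakayama: an element of `P` is `c * f + t * d`, and `t ∉ P` forces `d ∈ P`.
  have hle : P ≤ Ideal.span {f} ⊔ maximalIdeal A • P := by
    intro a ha
    have h1 : Ideal.Quotient.mk (Ideal.span {t}) a ∈
        P.map (Ideal.Quotient.mk (Ideal.span {t})) := Ideal.mem_map_of_mem _ ha
    rw [hf, Submodule.mem_span_singleton] at h1
    obtain ⟨c, hc⟩ := h1
    obtain ⟨c, rfl⟩ := Ideal.Quotient.mk_surjective c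
    rw [smul_eq_mul, ← map_mul, eq_comm, Ideal.Quotient.eq, Ideal.mem_span_singleton] at hc
    obtain ⟨d, hd⟩ := hc
    have hdP : d ∈ P := by
      refine (hPp.mem_or_mem (x := t) ?_).resolve_left htP
      rw [← hd]
      exact P.sub_mem ha (P.mul_mem_left _ hfP)
    rw [show a = c * f + t * d by rw [← hd]; ring]
    refine Submodule.add_mem_sup (Ideal.mem_span_singleton'.mpr ⟨c, rfl⟩)
      (Submodule.smul_mem_smul ?_ hdP)
    exact fun hu ↦ ht.not_isUnit hu
  have hPf : P = Ideal.span {f} := by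
    refine le_antisymm ?_ ((Ideal.span_singleton_le_iff_mem _).mpr hfP)
    exact Submodule.le_of_le_smul_of_le_jacobson_bot (IsNoetherian.noetherian _)
      (IsLocalRing.maximalIdeal_le_jacobson _) hle
  have hf0 : f ≠ 0 := by
    rintro rfl
    exact hP (by simpa using hPf)
  exact ⟨f, hfP, (Ideal.span_singleton_prime hf0).mp (hPf ▸ hPp)⟩

/-- Killing a nonzero element of the domain lowers the dimension, and a zero-dimensional quotient
domain would be a field. -/
theorem mem_specOne_of_ne {A : Type*} [CommRing A] [IsDomain A] [IsLocalRing A]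
    (hdim : ringKrullDim A = 2) (P : PrimeSpectrum A) (h0 : P.asIdeal ≠ ⊥)
    (hm : P.asIdeal ≠ maximalIdeal A) : P ∈ specOne A := by
  obtain ⟨a, haP, ha0⟩ := Submodule.exists_mem_ne_zero_of_ne_bot h0
  have h1 := ringKrullDim_quotient_succ_le_of_nonZeroDivisor (mem_nonZeroDivisors_of_ne_zero ha0)
  rw [hdim] at h1
  have h2 : ringKrullDim (A ⧸ P.asIdeal) ≤ ringKrullDim (A ⧸ Ideal.span {a}) :=
    ringKrullDim_le_of_surjective
      (Ideal.Quotient.factor ((Ideal.span_singleton_le_iff_mem _).mpr haP))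
      (Ideal.Quotient.factor_surjective _)
  have h3 : ringKrullDim (A ⧸ P.asIdeal) + 1 ≤ 2 := (add_le_add_left h2 1).trans h1
  have h4 : ringKrullDim (A ⧸ P.asIdeal) ≠ 0 := by
    intro h
    have : Ring.KrullDimLE 0 (A ⧸ P.asIdeal) := by
      rw [Ring.krullDimLE_iff, h]; rfl
    have hf := Ring.KrullDimLE.isField_of_isDomain (R := A ⧸ P.asIdeal)
    exact hm (eq_maximalIdeal (Ideal.Quotient.maximal_of_isField _ hf))
  have h5 : 0 ≤ ringKrullDim (A ⧸ P.asIdeal) := ringKrullDim_nonneg_of_nontrivial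
  change ringKrullDim (A ⧸ P.asIdeal) = 1
  generalize ringKrullDim (A ⧸ P.asIdeal) = d at h3 h4 h5
  cases d with
  | bot => simp at h5
  | coe d =>
    cases d with
    | top => exact absurd h3 (by decide)
    | coe d =>
      norm_cast at h3 h4 h5 ⊢
      have : d + 1 ≤ 2 := by exact_mod_cast h3
      have : d ≠ 0 := by exact_mod_cast h4
      have : d = 1 := by omega
      subst this; rfl

end RegularSurface

/-! ### The ramification jump of an Artin–Schreier extension over a discrete valuation ring -/

section ArtinSchreierJump

/-- By the twisted product rule, `σ - 1` raises the `Q`-adic order by at least `i`, not only on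
uniformizers. For `k = 0` this is one weaker than the hypothesis. -/
theorem Ideal.smul_sub_mem_pow_add {G S : Type*} [Group G] [CommRing S] [MulSemiringAction G S]
    {Q : Ideal S} {i : ℕ} {σ : G} (hσ : σ ∈ (Q ^ (i + 1)).inertia G) (k : ℕ) {y : S}
    (hy : y ∈ Q ^ k) : σ • y - y ∈ Q ^ (k + i) := by
  induction k generalizing y with
  | zero => exact Ideal.pow_le_pow_right (by omega) (hσ y)
  | succ k ih =>
    rw [pow_succ] at hy
    induction hy using Submodule.mul_induction_on' with
    | mem_mul_mem a ha b hb =>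
      have h1 : σ • a ∈ Q ^ k := by
        rw [← sub_add_cancel (σ • a) a]
        exact Ideal.add_mem _ (Ideal.pow_le_pow_right (by omega) (ih ha)) ha
      rw [show σ • (a * b) - a * b = σ • a * (σ • b - b) + (σ • a - a) * b by
        rw [smul_mul']; ring]
      refine Ideal.add_mem _ ?_ ?_
      · have := Ideal.mul_mem_mul h1 (hσ b)
        rwa [← pow_add, show k + (i + 1) = k + 1 + i by ring] at this
      · have := Ideal.mul_mem_mul (ih ha) hb
        rwa [← pow_succ, show k + i + 1 = k + 1 + i by ring] at this
    | add a _ b _ ha hb =>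
      rw [show σ • (a + b) - (a + b) = (σ • a - a) + (σ • b - b) by rw [smul_add]; ring]
      exact Ideal.add_mem _ ha hb

/-- If `y ^ p = g ^ (p - 1) * (y + c)` with `g` of order `p * N` at the prime `Q`, then an
automorphism moving `y` does not lie in `G_i` for `i > N`. -/
theorem le_of_mem_inertia_pow {S G : Type*} [CommRing S] [IsDedekindDomain S] [Group G]
    [MulSemiringAction G S] {p : ℕ} [Fact p.Prime] [CharP S p] {Q : Ideal S} (hQ : Prime Q)
    {g c y : S} {N : ℕ} (hN : emultiplicity Q (Ideal.span {g}) = (p * N : ℕ))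
    (hy : y ^ p = g ^ (p - 1) * (y + c)) {σ : G} (hg : σ • g = g) (hc : σ • c = c)
    (hσy : σ • y ≠ y) {i : ℕ} (hσ : σ ∈ (Q ^ (i + 1)).inertia G) : i ≤ N := by
  have hp := (Fact.out : p.Prime)
  have hp2 := hp.two_le
  set v : S → ℕ∞ := fun z ↦ emultiplicity Q (Ideal.span {z}) with hv
  have hvmul : ∀ a b, v (a * b) = v a + v b := fun a b ↦ by
    simp only [hv, ← Ideal.span_singleton_mul_span_singleton, emultiplicity_mul hQ]
  have hvpow : ∀ a (k : ℕ), v (a ^ k) = k * v a := fun a k ↦ by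
    simp only [hv, ← Ideal.span_singleton_pow, emultiplicity_pow hQ]
  have hmem : ∀ z (k : ℕ), z ∈ Q ^ k ↔ (k : ℕ∞) ≤ v z := fun z k ↦ by
    rw [← Ideal.dvd_span_singleton, pow_dvd_iff_le_emultiplicity]
  have hvg : v g = (p * N : ℕ) := hN
  -- Both sides of the equation have order at least `(p - 1) * p * N`; divide by `p`. Only
  -- integrality of `y + c` is used.
  have hy1 : y ∈ Q ^ ((p - 1) * N) := by
    rw [hmem]
    have h1 : (p : ℕ∞) * v y = ((p - 1 : ℕ) : ℕ∞) * (p * N : ℕ) + v (y + c) := by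
      rw [← hvpow, hy, hvmul, hvpow, hvg]
    generalize v y = a at h1
    cases a with
    | top => exact le_top
    | coe a =>
      have h2 : ((p - 1 : ℕ) : ℕ∞) * (p * N : ℕ) ≤ (p : ℕ∞) * a := by rw [h1]; exact le_self_add
      have h3 : (p - 1) * (p * N) ≤ p * a := by exact_mod_cast h2
      have h4 : p * ((p - 1) * N) ≤ p * a := by linarith [mul_left_comm p (p - 1) N]
      exact_mod_cast Nat.le_of_mul_le_mul_left h4 hp.pos
  have hw := Ideal.smul_sub_mem_pow_add hσ _ hy1
  set w := σ • y - y with hwdef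
  have hw0 : w ≠ 0 := sub_ne_zero.mpr hσy
  -- Subtracting the equation from its conjugate cancels `c`, because Frobenius is additive. So `w`
  -- has order exactly `p * N`, while it lies in `Q ^ ((p - 1) * N + i)`.
  have hwp : w ^ p = g ^ (p - 1) * w := by
    have h1 : (σ • y) ^ p = g ^ (p - 1) * (σ • y + c) := by
      rw [← smul_pow', hy, smul_mul', smul_pow', smul_add, hg, hc]
    rw [hwdef, sub_pow_char, h1, hy]
    ring
  have hwg : w ^ (p - 1) = g ^ (p - 1) := by
    apply mul_right_cancel₀ hw0
    rw [← hwp, ← pow_succ, Nat.sub_add_cancel hp.one_le]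
  have h1 : ((p - 1 : ℕ) : ℕ∞) * v w = ((p - 1 : ℕ) : ℕ∞) * (p * N : ℕ) := by
    rw [← hvpow, hwg, hvpow, hvg]
  rw [hmem] at hw
  have h2 : (((p - 1) * N + i : ℕ) : ℕ∞) ≤ (p * N : ℕ) := by
    refine hw.trans ?_
    generalize v w = a at h1
    cases a with
    | top =>
      rw [ENat.mul_top (by exact_mod_cast (by omega : p - 1 ≠ 0))] at h1
      exact absurd h1 (by exact_mod_cast ENat.top_ne_natCast _)
    | coe a =>
      have h3 : (p - 1) * a = (p - 1) * (p * N) := by exact_mod_cast h1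
      exact_mod_cast (Nat.eq_of_mul_eq_mul_left (by omega) h3).le
  have h3 : (p - 1) * N + i ≤ p * N := by exact_mod_cast h2
  obtain ⟨k, rfl⟩ : ∃ k, p = k + 1 := ⟨p - 1, by omega⟩
  simp only [Nat.add_sub_cancel, add_mul, one_mul] at h3
  omega

theorem isSeparable_of_pow_eq {F E : Type*} [Field F] [Field E] [Algebra F E] {p : ℕ}
    [Fact p.Prime] [CharP F p] {u v : F} (hu : u ≠ 0) {y : E}
    (hy : y ^ p = algebraMap F E u * y + algebraMap F E v) : IsSeparable F y := by
  open Polynomial in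
  have hsep : (X ^ p - (C u * X + C v) : F[X]).Separable := by
    rw [Polynomial.separable_def]
    simp only [derivative_sub, derivative_X_pow, CharP.cast_eq_zero, derivative_add,
      derivative_C_mul, derivative_X, derivative_C, map_zero, zero_mul, mul_one, add_zero,
      zero_sub]
    obtain ⟨b, hb⟩ := (isUnit_C.mpr hu.isUnit).neg.exists_left_inv
    exact ⟨0, b, by rw [hb, zero_mul, zero_add]⟩
  exact hsep.of_dvd (minpoly.dvd F y (by simp [hy]))

theorem AlgEquiv.eq_one_of_adjoin_simple_eq_top {F E : Type*} [Field F] [Field E] [Algebra F E]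
    {y : E} (hy : IntermediateField.adjoin F {y} = ⊤) {σ : E ≃ₐ[F] E} (hσ : σ y = y) : σ = 1 := by
  have h : IntermediateField.adjoin F {y} ≤
      IntermediateField.fixedField (Subgroup.zpowers σ) := by
    rw [IntermediateField.adjoin_le_iff, Set.singleton_subset_iff]
    rintro ⟨τ, hτ⟩
    have : Subgroup.zpowers σ ≤ MulAction.stabilizer (E ≃ₐ[F] E) y := by
      rw [Subgroup.zpowers_le]; exact hσ
    exact this hτ
  rw [hy] at h
  ext z
  exact h (IntermediateField.mem_top (x := z)) ⟨σ, Subgroup.mem_zpowers σ⟩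

/-- If the ramification index is `p`, the order of `g` upstairs is `p` times its order in `R`, as
`le_of_mem_inertia_pow` requires. Otherwise the supremum is over an empty family. -/
theorem localJump_le_of_pow_eq {R F E : Type*} [CommRing R] [IsDomain R]
    [IsDiscreteValuationRing R] [Field F] [Field E] [Algebra R F] [IsFractionRing R F]
    [Algebra F E] [Algebra R E] [IsScalarTower R F E] {p : ℕ} [Fact p.Prime] [CharP R p]
    {g c : R} {y : E} {N : ℕ} (hg : g ∉ IsLocalRing.maximalIdeal R ^ (N + 1))
    (hy : y ^ p = algebraMap R E (g ^ (p - 1)) * (y + algebraMap R E c))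
    (hgen : IntermediateField.adjoin F {y} = ⊤) : localJump R F E p ≤ N := by
  have hp := (Fact.out : p.Prime)
  have hRF := IsFractionRing.injective R F
  have hRE : Function.Injective (algebraMap R E) := by
    rw [IsScalarTower.algebraMap_eq R F E]
    exact (algebraMap F E).injective.comp hRF
  have : CharP F p := charP_of_injective_algebraMap hRF p
  have : FaithfulSMul R E := (faithfulSMul_iff_algebraMap_injective R E).mpr hRE
  have hg0 : g ≠ 0 := by rintro rfl; exact hg (Ideal.zero_mem _)
  -- Separability, together with finiteness, makes the integral closure a Dedekind domain.
  have hsep : IsSeparable F y := by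
    refine isSeparable_of_pow_eq (p := p) (u := algebraMap R F (g ^ (p - 1)))
      (v := algebraMap R F (g ^ (p - 1) * c)) ?_ ?_
    · rw [Ne, map_eq_zero_iff _ hRF]
      exact pow_ne_zero _ hg0
    · rw [hy, ← IsScalarTower.algebraMap_apply, ← IsScalarTower.algebraMap_apply, map_mul]
      ring
  have hfin : FiniteDimensional F E := by
    have := IntermediateField.adjoin.finiteDimensional hsep.isIntegral
    rw [hgen] at this
    exact (IntermediateField.topEquiv (F := F) (E := E)).toLinearEquiv.finiteDimensional
  have hsepE : Algebra.IsSeparable F E := by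
    have := (IntermediateField.isSeparable_adjoin_simple_iff_isSeparable F E).mpr hsep
    rw [hgen] at this
    exact Algebra.IsSeparable.of_algHom F _
      (IntermediateField.topEquiv (F := F) (E := E)).symm.toAlgHom
  have : IsDedekindDomain (integralClosure R E) := integralClosure.isDedekindDomain R F E
  set S := integralClosure R E
  have : FaithfulSMul R S := by
    rw [faithfulSMul_iff_algebraMap_injective]
    intro a b hab
    exact hRE (congrArg (algebraMap S E) hab)
  have hRS := FaithfulSMul.algebraMap_injective R S
  have : CharP S p := charP_of_injective_algebraMap hRS p
  have hyint : IsIntegral R y := by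
    open Polynomial in
    refine ⟨X ^ p - (C (g ^ (p - 1)) * X + C (g ^ (p - 1) * c)), ?_, ?_⟩
    · refine monic_X_pow_sub (lt_of_le_of_lt degree_linear_le ?_)
      exact_mod_cast hp.one_lt
    · simp only [eval₂_sub, eval₂_X_pow, hy, eval₂_add, eval₂_mul, eval₂_C, eval₂_X, map_mul]
      ring
  refine iSup_le fun Q ↦ iSup_le fun hQ ↦ iSup_le fun he ↦ iSup_le fun i ↦ iSup_le fun hi ↦ ?_
  obtain ⟨ϖ, hϖ⟩ := IsDiscreteValuationRing.exists_irreducible R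
  obtain ⟨n, u, hgn⟩ := IsDiscreteValuationRing.eq_unit_mul_pow_irreducible hg0 hϖ
  have hnN : n ≤ N := by
    by_contra! h
    apply hg
    rw [hgn, hϖ.maximalIdeal_eq, Ideal.span_singleton_pow]
    exact Ideal.mul_mem_left _ _ (Ideal.mem_span_singleton.mpr (pow_dvd_pow _ h))
  have hover : Q.LiesOver (IsLocalRing.maximalIdeal R) := ⟨by
    have := Ideal.isMaximal_comap_of_isIntegral_of_isMaximal (R := R) Q
    exact (IsLocalRing.eq_maximalIdeal this).symm⟩
  have hmap : (IsLocalRing.maximalIdeal R).map (algebraMap R S) ≠ ⊥ := by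
    rw [Ne, Ideal.map_eq_bot_iff_of_injective hRS]
    exact IsDiscreteValuationRing.not_a_field R
  have hQ0 : Q ≠ ⊥ := by
    rintro rfl
    exact hmap (le_bot_iff.mp (Ideal.map_le_iff_le_comap.mpr hover.over.le))
  have hQp : Prime Q := Ideal.prime_of_isPrime hQ0 hQ.isPrime
  have hmult := Ideal.IsDedekindDomain.ramificationIdx_eq_multiplicity
    (IsLocalRing.maximalIdeal R) Q hmap
  rw [he] at hmult
  have hem : emultiplicity Q (Ideal.span {algebraMap R S g}) = (p * n : ℕ) := by
    have h1 : Ideal.span {algebraMap R S g} =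
        ((IsLocalRing.maximalIdeal R).map (algebraMap R S)) ^ n := by
      rw [hϖ.maximalIdeal_eq, Ideal.map_span, Set.image_singleton, Ideal.span_singleton_pow,
        hgn, map_mul, map_pow, Ideal.span_singleton_mul_left_unit (u.isUnit.map _)]
    rw [h1, emultiplicity_pow hQp,
      (FiniteMultiplicity.of_prime_left hQp hmap).emultiplicity_eq_multiplicity, ← hmult,
      mul_comm]
    push_cast
    rfl
  obtain ⟨σ, hσ, hσ1⟩ : ∃ σ ∈ lowerRamificationGroup R F E Q i, σ ≠ 1 := by
    by_contra! h
    rw [(Subgroup.eq_bot_iff_forall _).mpr h, Subgroup.card_bot] at hi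
    exact hp.one_lt.ne hi
  have hfix : ∀ r : R, σ • algebraMap R S r = algebraMap R S r := fun r ↦
    Subtype.ext (by
      change σ (algebraMap R E r) = algebraMap R E r
      rw [IsScalarTower.algebraMap_apply R F E, σ.commutes])
  have := le_of_mem_inertia_pow (y := (⟨y, hyint⟩ : S)) (c := algebraMap R S c) hQp hem
    (Subtype.ext (by rw [← map_pow]; exact hy)) (hfix g) (hfix c)
    (fun h ↦ hσ1 (AlgEquiv.eq_one_of_adjoin_simple_eq_top hgen (congrArg Subtype.val h))) hσ
  exact_mod_cast this.trans hnN

end ArtinSchreierJump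

/-! ### The residue extension at a prime where the Artin–Schreier equation is integral -/

section ResidueExtension

theorem IsIntegral.of_pow_eq_mul_add {A L : Type*} [CommRing A] [CommRing L] [Algebra A L]
    {p : ℕ} (hp : 1 < p) {u v : A} {y : L}
    (hy : y ^ p = algebraMap A L u * y + algebraMap A L v) : IsIntegral A y := by
  open Polynomial in
  nontriviality A
  refine ⟨X ^ p - (C u * X + C v), monic_X_pow_sub (degree_linear_le.trans_lt ?_), ?_⟩
  · exact_mod_cast hp
  · simp [hy]

/-- If `y ^ p = u * y + v` generates `L / K`, where `u`, `v` lie in the integrally closed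
domain `A` of characteristic `p` with fraction field `K`, then some power of `u` multiplies the
integral closure of `A` into `A[y]`. -/
theorem exists_pow_smul_mem_adjoin {A K L : Type*} [CommRing A] [IsDomain A]
    [IsIntegrallyClosed A] [Field K] [Algebra A K] [IsFractionRing A K] [Field L] [Algebra K L]
    [Algebra A L] [IsScalarTower A K L] {p : ℕ} [Fact p.Prime] [CharP A p] [IsGalois K L]
    (hdeg : Module.finrank K L = p) {u v : A} {y : L}
    (hy : y ^ p = algebraMap A L u * y + algebraMap A L v)
    (hgen : IntermediateField.adjoin K {y} = ⊤) :
    ∃ n : ℕ, ∀ b : L, IsIntegral A b →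
      algebraMap A L (u ^ n) * b ∈ Algebra.adjoin A {y} := by
  have hp := (Fact.out : p.Prime)
  have hfin : FiniteDimensional K L := Module.finite_of_finrank_pos (hdeg ▸ hp.pos)
  have : CharP K p := charP_of_injective_algebraMap (IsFractionRing.injective A K) p
  have hint : IsIntegral A y := .of_pow_eq_mul_add hp.one_lt hy
  have hintK : IsIntegral K y := hint.tower_top
  have htop : Algebra.adjoin K {y} = ⊤ := by
    rw [← IntermediateField.adjoin_simple_toSubalgebra_of_isAlgebraic hintK.isAlgebraic, hgen,
      IntermediateField.top_toSubalgebra]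
  set pb := PowerBasis.ofAdjoinEqTop hintK htop
  have hpbgen : pb.gen = y := PowerBasis.ofAdjoinEqTop_gen hintK htop
  set u' := algebraMap A K u
  set v' := algebraMap A K v
  have hminpoly : minpoly K y = .X ^ p - (.C u' * .X + .C v') := by
    open Polynomial in
    have hmonic : (X ^ p - (C u' * X + C v') : K[X]).Monic := by
      refine monic_X_pow_sub (degree_linear_le.trans_lt ?_)
      exact_mod_cast hp.one_lt
    refine (eq_of_monic_of_dvd_of_natDegree_le (minpoly.monic hintK) hmonic
      (minpoly.dvd _ _ ?_) ?_).symm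
    · simp [hy, u', v', ← IsScalarTower.algebraMap_apply]
    · have h1 : (minpoly K y).natDegree = p := by
        rw [← hpbgen, pb.natDegree_minpoly, ← pb.finrank, hdeg]
      rw [h1]
      refine (natDegree_sub_le _ _).trans (max_le (natDegree_X_pow p).le
        (natDegree_linear_le.trans hp.one_le))
  -- The derivative of `X ^ p - u * X - v` is the constant `-u`, whose norm is `(-u) ^ p`. The sign
  -- `ε` is its own inverse and is cancelled at the end.
  have hdiscr : ∃ ε : A, ε * ε = 1 ∧
      Algebra.discr K pb.basis = algebraMap A K (ε * u ^ p) := by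
    rw [Algebra.discr_powerBasis_eq_norm, hpbgen, hminpoly]
    simp only [Polynomial.derivative_sub, Polynomial.derivative_X_pow, CharP.cast_eq_zero,
      Polynomial.derivative_add, Polynomial.derivative_C_mul, Polynomial.derivative_X,
      Polynomial.derivative_C, map_zero, zero_mul, mul_one, add_zero, zero_sub, map_neg,
      Polynomial.aeval_C]
    rw [← map_neg, Algebra.norm_algebraMap, hdeg, neg_pow]
    generalize p * (p - 1) / 2 = k
    refine ⟨(-1) ^ k * (-1) ^ p, ?_, ?_⟩
    · rw [← pow_add, ← pow_add]
      exact Even.neg_one_pow ⟨_, rfl⟩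
    · simp only [map_mul, map_pow, map_neg, map_one, u']
      ring
  obtain ⟨ε, hε, hd⟩ := hdiscr
  refine ⟨p, fun b hb ↦ ?_⟩
  have h1 := Algebra.discr_mul_isIntegral_mem_adjoin K (B := pb) (by rwa [hpbgen]) hb
  rw [hd, hpbgen] at h1
  have h2 := Subalgebra.smul_mem _ h1 ε
  rw [Algebra.smul_def, Algebra.smul_def, ← IsScalarTower.algebraMap_apply, ← mul_assoc,
    ← map_mul, ← mul_assoc, hε, one_mul] at h2
  exact h2

/-- Each integral element becomes a polynomial in `y` after multiplication by a power of `u`. Since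
`u ∉ P`, that power is invertible in the residue field of `P`, so reducing modulo `q` loses nothing.
-/
theorem adjoin_residue_eq_top
    {A K L F E : Type*} [CommRing A] [IsDomain A]
    [IsIntegrallyClosed A] [Field K] [Algebra A K] [IsFractionRing A K] [Field L] [Algebra K L]
    [Algebra A L] [IsScalarTower A K L] {p : ℕ} [Fact p.Prime] [CharP A p] [IsGalois K L]
    {P : Ideal A} {q : Ideal (integralClosure A L)} [q.LiesOver P] [q.IsPrime]
    [Field F] [Algebra (A ⧸ P) F] [IsFractionRing (A ⧸ P) F]
    [Field E] [Algebra (integralClosure A L ⧸ q) E] [IsFractionRing (integralClosure A L ⧸ q) E]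
    [Algebra F E] [Algebra (A ⧸ P) E] [IsScalarTower (A ⧸ P) F E]
    [IsScalarTower (A ⧸ P) (integralClosure A L ⧸ q) E]
    (hdeg : Module.finrank K L = p) {u v : A} (hu : u ∉ P)
    (y : integralClosure A L)
    (hy : (y : L) ^ p = algebraMap A L u * y + algebraMap A L v)
    (hgen : IntermediateField.adjoin K {(y : L)} = ⊤) :
    IntermediateField.adjoin F
      {algebraMap (integralClosure A L ⧸ q) E (Ideal.Quotient.mk q y)} = ⊤ := by
  obtain ⟨n, hn⟩ := exists_pow_smul_mem_adjoin hdeg hy hgen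
  set M := IntermediateField.adjoin F
    {algebraMap (integralClosure A L ⧸ q) E (Ideal.Quotient.mk q y)}
  let φ : integralClosure A L →+* E := (algebraMap (integralClosure A L ⧸ q) E).comp
    (Ideal.Quotient.mk q)
  have hφA : ∀ a : A, φ (algebraMap A _ a) =
      algebraMap F E (algebraMap (A ⧸ P) F (Ideal.Quotient.mk P a)) := fun a ↦ by
    rw [← IsScalarTower.algebraMap_apply,
      IsScalarTower.algebraMap_apply (A ⧸ P) (integralClosure A L ⧸ q) E]
    rfl
  have hyM : φ y ∈ M := IntermediateField.mem_adjoin_simple_self F _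
  have hmem : ∀ b, φ b ∈ M := by
    intro b
    have h1 := hn b b.2
    rw [Algebra.adjoin_singleton_eq_range_aeval] at h1
    obtain ⟨f, hf⟩ := h1
    have h2 : algebraMap A (integralClosure A L) (u ^ n) * b = Polynomial.aeval y f := by
      apply Subtype.ext
      change Polynomial.aeval (y : L) f = algebraMap A L (u ^ n) * b at hf
      rw [← Polynomial.aeval_subalgebra_coe] at hf
      exact hf.symm
    have h3 : φ (algebraMap A (integralClosure A L) (u ^ n)) * φ b ∈ M := by
      rw [← map_mul, h2, Polynomial.aeval_def, Polynomial.hom_eval₂, Polynomial.eval₂_eq_sum]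
      refine sum_mem fun i _ ↦ mul_mem ?_ (pow_mem hyM i)
      rw [RingHom.comp_apply, hφA]
      exact M.algebraMap_mem _
    have h4 : φ (algebraMap A (integralClosure A L) (u ^ n)) ≠ 0 := by
      rw [map_pow, map_pow, hφA]
      refine pow_ne_zero n ?_
      rw [Ne, map_eq_zero, map_eq_zero_iff _ (IsFractionRing.injective (A ⧸ P) F),
        Ideal.Quotient.eq_zero_iff_mem]
      exact hu
    have h5 : φ (algebraMap A (integralClosure A L) (u ^ n)) ∈ M := by
      rw [hφA]
      exact M.algebraMap_mem _
    rw [← inv_mul_cancel_left₀ h4 (φ b)]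
    exact mul_mem (inv_mem h5) h3
  rw [eq_top_iff]
  intro z _
  obtain ⟨a, b, -, rfl⟩ := IsFractionRing.div_surjective (integralClosure A L ⧸ q) z
  obtain ⟨a, rfl⟩ := Ideal.Quotient.mk_surjective a
  obtain ⟨b, rfl⟩ := Ideal.Quotient.mk_surjective b
  exact div_mem (hmem a) (hmem b)

/-- Clearing the denominator of `a` turns `x` into the integral generator `f * x`, whose equation
can be reduced modulo `q`. -/
theorem localJump_residue_le
    {A K L F E : Type*} [CommRing A] [IsDomain A]
    [IsIntegrallyClosed A] [Field K] [Algebra A K] [IsFractionRing A K] [Field L] [Algebra K L]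
    [Algebra A L] [IsScalarTower A K L] {p : ℕ} [Fact p.Prime] [CharP A p] [IsGalois K L]
    {P : Ideal A} {q : Ideal (integralClosure A L)} [q.LiesOver P] [q.IsPrime]
    [Field F] [Algebra (A ⧸ P) F] [IsFractionRing (A ⧸ P) F]
    [Field E] [Algebra (integralClosure A L ⧸ q) E] [IsFractionRing (integralClosure A L ⧸ q) E]
    [Algebra F E] [Algebra (A ⧸ P) E] [IsScalarTower (A ⧸ P) F E]
    [IsScalarTower (A ⧸ P) (integralClosure A L ⧸ q) E]
    (hdeg : Module.finrank K L = p)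
    [P.IsPrime] [IsDiscreteValuationRing (A ⧸ P)] {x : L} {a : K} {f c : A} {N : ℕ}
    (hf : Ideal.Quotient.mk P f ∉ IsLocalRing.maximalIdeal (A ⧸ P) ^ (N + 1))
    (hfa : a * algebraMap A K f = algebraMap A K c)
    (hx : x ^ p - x = algebraMap K L a) (hgen : IntermediateField.adjoin K {x} = ⊤) :
    localJump (A ⧸ P) F E p ≤ N := by
  have hp := (Fact.out : p.Prime)
  have hfP : f ∉ P := by
    intro h
    rw [Ideal.Quotient.eq_zero_iff_mem.mpr h] at hf
    exact hf (Ideal.zero_mem _)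
  have hf0 : algebraMap A K f ≠ 0 := by
    rw [Ne, map_eq_zero_iff _ (IsFractionRing.injective A K)]
    rintro rfl
    exact hfP P.zero_mem
  have hpp : p - 1 + 1 = p := Nat.sub_add_cancel hp.one_le
  have hy : (algebraMap A L f * x) ^ p =
      algebraMap A L (f ^ (p - 1)) * (algebraMap A L f * x) +
        algebraMap A L (f ^ (p - 1) * c) := by
    have h1 : algebraMap A L c = algebraMap K L a * algebraMap A L f := by
      rw [IsScalarTower.algebraMap_apply A K L c, ← hfa, map_mul,
        ← IsScalarTower.algebraMap_apply]
    rw [map_mul, h1, ← hx, mul_pow, map_pow]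
    nth_rewrite 1 [← hpp]
    rw [pow_succ]
    ring
  have hgen' : IntermediateField.adjoin K {algebraMap A L f * x} = ⊤ := by
    rw [eq_top_iff, ← hgen, IntermediateField.adjoin_le_iff, Set.singleton_subset_iff]
    have h1 : (algebraMap K L (algebraMap A K f))⁻¹ * (algebraMap A L f * x) ∈
        IntermediateField.adjoin K {algebraMap A L f * x} :=
      mul_mem (inv_mem (IntermediateField.algebraMap_mem _ _))
        (IntermediateField.mem_adjoin_simple_self K _)
    rwa [← IsScalarTower.algebraMap_apply, inv_mul_cancel_left₀] at h1
    rwa [IsScalarTower.algebraMap_apply A K L, Ne, map_eq_zero]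
  set y : integralClosure A L := ⟨_, IsIntegral.of_pow_eq_mul_add hp.one_lt hy⟩
  have hchar : CharP (A ⧸ P) p :=
    (CharP.charP_iff_prime_eq_zero hp).mpr (by
      rw [← map_natCast (Ideal.Quotient.mk P), CharP.cast_eq_zero, map_zero])
  refine localJump_le_of_pow_eq (g := Ideal.Quotient.mk P f) (c := Ideal.Quotient.mk P c) hf ?_
    (adjoin_residue_eq_top (q := q) hdeg (fun h ↦ hfP (‹P.IsPrime›.mem_of_pow_mem _ h)) y hy hgen')
  have h2 : y ^ p = algebraMap A _ (f ^ (p - 1)) * y + algebraMap A _ (f ^ (p - 1) * c) :=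
    Subtype.ext hy
  have h3 : ∀ r : A, algebraMap (A ⧸ P) E (Ideal.Quotient.mk P r) =
      algebraMap (integralClosure A L ⧸ q) E (Ideal.Quotient.mk q (algebraMap A _ r)) := fun r ↦ by
    rw [IsScalarTower.algebraMap_apply (A ⧸ P) (integralClosure A L ⧸ q) E]
    rfl
  rw [← map_pow, ← map_pow, h2, ← map_pow, h3, h3]
  simp only [map_add, map_mul]
  ring

end ResidueExtension

/-! ### The jump at a single prime. -/

section ResidueJump

theorem residueJump_le {A K L : Type*} [CommRing A] [IsDomain A]
    [IsIntegrallyClosed A] [Field K] [Algebra A K] [IsFractionRing A K] [Field L] [Algebra K L]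
    [Algebra A L] [IsScalarTower A K L] {p : ℕ} [Fact p.Prime] [CharP A p] [IsGalois K L]
    (hdeg : Module.finrank K L = p) {P : Ideal A} [P.IsPrime] [IsDiscreteValuationRing (A ⧸ P)]
    (q : Ideal (integralClosure A L)) [q.IsPrime] [q.LiesOver P]
    {x : L} {a : K} {f c : A} {N : ℕ}
    (hf : Ideal.Quotient.mk P f ∉ IsLocalRing.maximalIdeal (A ⧸ P) ^ (N + 1))
    (hfa : a * algebraMap A K f = algebraMap A K c)
    (hx : x ^ p - x = algebraMap K L a) (hgen : IntermediateField.adjoin K {x} = ⊤) :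
    residueJump L p P q ≤ N := by
  let : Algebra (FractionRing (A ⧸ P)) (FractionRing (integralClosure A L ⧸ q)) :=
    FractionRing.liftAlgebra (A ⧸ P) (FractionRing (integralClosure A L ⧸ q))
  exact localJump_residue_le (q := q) hdeg hf hfa hx hgen

end ResidueJump

/-! ### The bound for the jumps -/

section Bound

open IsLocalRing

theorem IsDiscreteValuationRing.mem_maximalIdeal_pow_iff {R : Type*} [CommRing R] [IsDomain R]
    [IsDiscreteValuationRing R] {x : R} {n : ℕ} :
    x ∈ IsLocalRing.maximalIdeal R ^ n ↔ (n : ℕ∞) ≤ addVal R x := by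
  obtain ⟨ϖ, hϖ⟩ := exists_irreducible R
  rw [hϖ.maximalIdeal_eq, Ideal.span_singleton_pow, Ideal.mem_span_singleton,
    ← addVal_le_iff_dvd, hϖ.addVal_pow]

theorem IsDiscreteValuationRing.addVal_prod_pow {R ι : Type*} [CommRing R] [IsDomain R]
    [IsDiscreteValuationRing R] (s : Finset ι) (t : ι → R) (m : ι → ℕ) :
    addVal R (∏ i ∈ s, t i ^ m i) = ∑ i ∈ s, m i * addVal R (t i) := by
  classical
  induction s using Finset.induction_on with
  | empty => simp
  | insert i s hi ih =>
    rw [Finset.prod_insert hi, Finset.sum_insert hi, addVal_mul, addVal_pow, ih, nsmul_eq_mul]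

/-- If `t` has order at least `n` on the curve `Q`, then `A ⧸ (Q + P)` surjects onto the quotient of
`A ⧸ Q` by the `n`-th power of its maximal ideal, which has length `n`. -/
theorem addVal_le_interNumber {A : Type*} [CommRing A] {Q P : PrimeSpectrum A}
    [IsDiscreteValuationRing (A ⧸ Q.asIdeal)] {t : A} (ht : P.asIdeal = Ideal.span {t}) :
    IsDiscreteValuationRing.addVal (A ⧸ Q.asIdeal) (Ideal.Quotient.mk _ t) ≤
      interNumber Q P := by
  set R := A ⧸ Q.asIdeal
  refine ENat.forall_natCast_le_iff_le.mp fun n hn ↦ ?_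
  rw [← IsDiscreteValuationRing.mem_maximalIdeal_pow_iff] at hn
  have hsurj : Function.Surjective (algebraMap A R) := Ideal.Quotient.mk_surjective
  have hlen : Module.length A (R ⧸ maximalIdeal R ^ n) = n := by
    rw [Module.length_eq_of_surjective (R := R) hsurj,
      IsDiscreteValuationRing.length_quotient_pow_maximalIdeal]
  rw [← hlen]
  let f : A →ₗ[A] R ⧸ maximalIdeal R ^ n :=
    (IsScalarTower.toAlgHom A R (R ⧸ maximalIdeal R ^ n)).toLinearMap ∘ₗ Algebra.linearMap A R
  have hf : Q.asIdeal ⊔ P.asIdeal ≤ LinearMap.ker f := by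
    refine sup_le (fun a ha ↦ ?_) ?_
    · have : algebraMap A R a = 0 := Ideal.Quotient.eq_zero_iff_mem.mpr ha
      simp [f, this]
    · rw [ht, Ideal.span_singleton_le_iff_mem]
      exact Ideal.Quotient.eq_zero_iff_mem.mpr hn
  refine Module.length_le_of_surjective (Submodule.liftQ _ f hf) ?_
  rw [← LinearMap.range_eq_top, Submodule.range_liftQ, LinearMap.range_eq_top]
  exact Ideal.Quotient.mk_surjective.comp hsurj

theorem exists_mul_prod_pow_eq_of_mem_adjoin {A K ι : Type*} [CommRing A] [Field K] [Algebra A K]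
    [Fintype ι] {t : ι → A} (ht : ∀ i, algebraMap A K (t i) ≠ 0) {a : K}
    (ha : a ∈ Algebra.adjoin A (Set.range fun i ↦ (algebraMap A K (t i))⁻¹)) :
    ∃ (k : ℕ) (c : A), a * algebraMap A K ((∏ i, t i) ^ k) = algebraMap A K c := by
  classical
  induction ha using Algebra.adjoin_induction with
  | mem x hx =>
    obtain ⟨i, rfl⟩ := hx
    refine ⟨1, ∏ j ∈ Finset.univ.erase i, t j, ?_⟩
    rw [pow_one, ← Finset.mul_prod_erase _ _ (Finset.mem_univ i), map_mul,
      inv_mul_cancel_left₀ (ht i)]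
  | algebraMap r => exact ⟨0, r, by simp⟩
  | add x y _ _ hx hy =>
    obtain ⟨k, c, hx⟩ := hx
    obtain ⟨l, d, hy⟩ := hy
    refine ⟨k + l, c * (∏ i, t i) ^ l + d * (∏ i, t i) ^ k, ?_⟩
    rw [map_add, map_mul, map_mul, ← hx, ← hy, pow_add, map_mul]
    ring
  | mul x y _ _ hx hy =>
    obtain ⟨k, c, hx⟩ := hx
    obtain ⟨l, d, hy⟩ := hy
    refine ⟨k + l, c * d, ?_⟩
    rw [map_mul, ← hx, ← hy, pow_add, map_mul]
    ring

/-- In a factorial domain, a fraction with poles only along pairwise non-associated primes `t i`,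
of order `m i` along `t i`, has denominator dividing `∏ t i ^ m i`. -/
theorem exists_mul_prod_pow_eq {A K ι : Type*} [CommRing A] [IsDomain A]
    [UniqueFactorizationMonoid A] [Field K] [Algebra A K] [IsFractionRing A K]
    [Fintype ι] {P : ι → PrimeSpectrum A} {t : ι → A}
    (ht : ∀ i, (P i).asIdeal = Ideal.span {t i}) (ht0 : ∀ i, t i ≠ 0)
    (hP : Function.Injective P) {a : K} {m : ι → ℕ}
    (ha : a ∈ Algebra.adjoin A (Set.range fun i ↦ (algebraMap A K (t i))⁻¹))
    (horder : ∀ i, HasOrderAt (P i) a (-(m i : ℤ))) :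
    ∃ c : A, a * algebraMap A K (∏ i, t i ^ m i) = algebraMap A K c := by
  have hinj := IsFractionRing.injective A K
  have htK : ∀ i, algebraMap A K (t i) ≠ 0 := fun i ↦ (map_ne_zero_iff _ hinj).mpr (ht0 i)
  have hprime : ∀ i, Prime (t i) := fun i ↦
    (Ideal.span_singleton_prime (ht0 i)).mp (ht i ▸ (P i).isPrime)
  obtain ⟨k, c, hc⟩ := exists_mul_prod_pow_eq_of_mem_adjoin htK ha
  -- Enlarging the common exponent to `k + l` makes the subtractions `k + l - m i` honest.
  obtain ⟨l, hl⟩ : ∃ l, ∀ i, m i ≤ k + l :=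
    ⟨∑ i, m i, fun i ↦ (Finset.single_le_sum (fun j _ ↦ (m j).zero_le)
      (Finset.mem_univ i)).trans (Nat.le_add_left _ _)⟩
  set f := ∏ i, t i with hf
  have hc' : a * algebraMap A K (f ^ (k + l)) = algebraMap A K (c * f ^ l) := by
    rw [map_mul, ← hc, pow_add, map_mul, mul_assoc]
  have hdvd : ∏ i, t i ^ (k + l - m i) ∣ c * f ^ l := by
    refine Fintype.prod_dvd_of_isRelPrime (fun i j hij ↦ ?_) fun i ↦ ?_
    · refine IsRelPrime.pow ((hprime i).irreducible.isRelPrime_iff_not_dvd.mpr fun h ↦ hij ?_)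
      have h1 : Associated (t i) (t j) :=
        (hprime i).irreducible.associated_of_dvd (hprime j).irreducible h
      apply hP
      ext1
      rw [ht, ht, Ideal.span_singleton_eq_span_singleton.mpr h1]
    · obtain ⟨s, x, y, hs, hx, hy, h⟩ := horder i
      rw [ht i, Ideal.mem_span_singleton] at hy
      have hst : Associated s (t i) := by
        rw [← Ideal.span_singleton_eq_span_singleton, ← hs, ht]
      have hs0 : algebraMap A K s ≠ 0 :=
        (map_ne_zero_iff _ hinj).mpr (hst.ne_zero_iff.mpr (ht0 i))
      rw [zpow_neg, zpow_natCast] at h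
      have h1 : c * f ^ l * y * s ^ m i = x * f ^ (k + l) := by
        apply hinj
        rw [map_mul, map_mul, ← hc', map_mul, map_pow _ s,
          mul_right_comm a, h]
        field_simp
      have h2 : t i ^ (k + l) ∣ c * f ^ l * y * t i ^ m i := by
        refine (dvd_mul_of_dvd_right (pow_dvd_pow_of_dvd
          (Finset.dvd_prod_of_mem t (Finset.mem_univ i)) _) x).trans ?_
        rw [← hf, ← h1]
        exact mul_dvd_mul_left _ (pow_dvd_pow_of_dvd hst.dvd _)
      rw [← Nat.sub_add_cancel (hl i), pow_add] at h2
      exact (hprime i).pow_dvd_of_dvd_mul_right _ hy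
        ((mul_dvd_mul_iff_right (pow_ne_zero _ (ht0 i))).mp h2)
  obtain ⟨e, he⟩ := hdvd
  refine ⟨e, ?_⟩
  have hsplit : (∏ i, t i ^ m i) * ∏ i, t i ^ (k + l - m i) = f ^ (k + l) := by
    rw [hf, ← Finset.prod_mul_distrib, ← Finset.prod_pow]
    exact Finset.prod_congr rfl fun i _ ↦ by rw [← pow_add, Nat.add_sub_cancel' (hl i)]
  have hne : algebraMap A K (∏ i, t i ^ (k + l - m i)) ≠ 0 :=
    (map_ne_zero_iff _ hinj).mpr (Finset.prod_ne_zero_iff.mpr fun i _ ↦ pow_ne_zero _ (ht0 i))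
  apply mul_right_cancel₀ hne
  rw [mul_assoc, ← map_mul, hsplit, hc', he, mul_comm, map_mul]

/-- The denominator `∏ t i ^ m i` does not depend on `Q`, and its order on `Q` is controlled by
intersection numbers that are constant on `T_r`; hence the uniform bound. -/
theorem genericJump_le {A K L : Type*} [CommRing A] [IsDomain A] [UniqueFactorizationMonoid A]
    [Field K] [Algebra A K] [IsFractionRing A K] [Field L] [Algebra K L]
    [Algebra A L] [IsScalarTower A K L] {p : ℕ} [Fact p.Prime] [CharP A p] [IsGalois K L]
    (hdeg : Module.finrank K L = p) {d : ℕ} {P : Fin d → PrimeSpectrum A}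
    (hP : Function.Injective P) (hP0 : ∀ i, (P i).asIdeal ≠ ⊥) {x : L} {a : K} {m : Fin d → ℕ}
    (hx : IsArtinSchreierGenerator p P x a m) (r : ℕ) :
    genericJump L p P r ≤ ((∑ i : Fin d, (if i.val = 0 then r else 1) * m i : ℕ) : ℕ∞) := by
  obtain ⟨t, ht, ha⟩ := hx.poles
  have ht0 : ∀ i, t i ≠ 0 := fun i h ↦ hP0 i (by rw [ht, h, Ideal.span_singleton_eq_bot])
  obtain ⟨c, hc⟩ := exists_mul_prod_pow_eq ht ht0 hP ha hx.order
  refine iSup₂_le fun Q hQ ↦ iSup_le fun q ↦ iSup_le fun hq ↦ iSup_le fun hqQ ↦ ?_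
  obtain ⟨⟨hQ1, hQreg, -⟩, hQP⟩ := hQ
  have := IsRegularLocalRing.isDiscreteValuationRing (R := A ⧸ Q.asIdeal) hQ1
  refine residueJump_le hdeg q (fun h ↦ ?_) hc hx.equation hx.generates
  rw [IsDiscreteValuationRing.mem_maximalIdeal_pow_iff, map_prod] at h
  simp only [map_pow] at h
  rw [IsDiscreteValuationRing.addVal_prod_pow] at h
  have h1 := h.trans (Finset.sum_le_sum fun i _ ↦
    mul_le_mul_right (addVal_le_interNumber (Q := Q) (ht i)) (m i : ℕ∞))
  have h2 : ∑ i, (m i : ℕ∞) * interNumber Q (P i) =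
      ((∑ i : Fin d, (if i.val = 0 then r else 1) * m i : ℕ) : ℕ∞) := by
    push_cast
    refine Finset.sum_congr rfl fun i _ ↦ ?_
    rw [hQP, mul_comm]
  rw [h2] at h1
  have h3 := ENat.natCast_le_natCast.mp h1
  omega

end Bound

/-! ### Existence of Artin–Schreier generators with poles along the branch locus -/

section Existence

open IsLocalRing

/-- The inertia group of a prime at which the extension is unramified acts trivially. -/
theorem smul_eq_of_mem_inertia_of_isUnramifiedAt {A B G : Type*} [CommRing A] [CommRing B]
    [IsDomain B] [IsNoetherianRing B] [Algebra A B] [Group G] [MulSemiringAction G B]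
    [SMulCommClass G A B] {q : Ideal B} [q.IsPrime] [Algebra.IsUnramifiedAt A q] {σ : G}
    (hσ : σ ∈ q.inertia G) (b : B) : σ • b = b := by
  set C := Localization.AtPrime q
  have hmem : ∀ b, b ∉ q → σ • b ∉ q := fun b hb h ↦ hb (by
    rw [show b = σ • b - (σ • b - b) by ring]
    exact q.sub_mem h (hσ b))
  let f : B →ₐ[A] C := (IsScalarTower.toAlgHom A B C).comp (MulSemiringAction.toAlgHom A B σ)
  have hf : ∀ b, f b = algebraMap B C (σ • b) := fun _ ↦ rfl
  have hunit : ∀ s : q.primeCompl, IsUnit (f s) := fun s ↦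
    IsLocalization.map_units C (⟨σ • (s : B), hmem s s.2⟩ : q.primeCompl)
  let g : C →ₐ[A] C := IsLocalization.liftAlgHom (M := q.primeCompl) hunit
  have hg : ∀ b, g (algebraMap B C b) = algebraMap B C (σ • b) := fun b ↦
    IsLocalization.lift_eq _ b
  -- The inertia condition says that `g` and the identity agree modulo the maximal ideal; formal
  -- unramifiedness lifts this to all its powers, whose intersection is zero.
  have hid : g = AlgHom.id A C := by
    refine Algebra.FormallyUnramified.ext_of_iInf _
      (Ideal.iInf_pow_eq_bot_of_isLocalRing (maximalIdeal C) Ideal.IsPrime.ne_top') fun x ↦ ?_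
    have : (Ideal.Quotient.mk (maximalIdeal C)).comp g.toRingHom =
        (Ideal.Quotient.mk (maximalIdeal C)).comp (RingHom.id C) := by
      refine IsLocalization.ringHom_ext q.primeCompl (RingHom.ext fun b ↦ ?_)
      change Ideal.Quotient.mk (maximalIdeal C) (g (algebraMap B C b)) =
        Ideal.Quotient.mk (maximalIdeal C) (algebraMap B C b)
      rw [hg, Ideal.Quotient.eq, ← map_sub, IsLocalization.AtPrime.to_map_mem_maximal_iff C q]
      exact hσ b
    exact RingHom.congr_fun this x
  apply IsLocalization.injective C q.primeCompl_le_nonZeroDivisors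
  rw [← hg, hid, AlgHom.id_apply]

/-- If the inertia group of a prime `q` is trivial, some trace lies outside `q`. -/
theorem exists_sum_smul_notMem {B G : Type*} [CommRing B] [Group G] [Fintype G]
    [MulSemiringAction G B] {q : Ideal B} [q.IsPrime] (hq : ∀ σ ∈ q.inertia G, σ = 1) :
    ∃ b : B, ∑ σ : G, σ • b ∉ q := by
  by_contra! h
  -- Trivial inertia makes these characters distinct, so by Dedekind their sum is not zero.
  let f : G → B →* B ⧸ q := fun σ ↦
    (Ideal.Quotient.mk q : B →* B ⧸ q).comp (MulSemiringAction.toRingHom G B σ : B →* B)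
  have hf : ∀ σ b, f σ b = Ideal.Quotient.mk q (σ • b) := fun _ _ ↦ rfl
  have hinj : Function.Injective f := by
    intro σ τ hστ
    rw [← mul_inv_eq_one]
    apply hq
    intro b
    have := DFunLike.congr_fun hστ (τ⁻¹ • b)
    rwa [hf, hf, Ideal.Quotient.eq, smul_inv_smul, ← mul_smul] at this
  have hli := (linearIndependent_monoidHom B (B ⧸ q)).comp f hinj
  rw [Fintype.linearIndependent_iff] at hli
  refine one_ne_zero (hli (fun _ ↦ 1) ?_ 1)
  funext b
  simp only [Function.comp_apply, one_smul, Finset.sum_apply, Pi.zero_apply, hf]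
  rw [← map_sum, Ideal.Quotient.eq_zero_iff_mem]
  exact h b

/-- Additive Hilbert 90 for a Galois extension of degree `p` in characteristic `p`. -/
theorem exists_artinSchreier_generator {K L : Type*} [Field K] [Field L] [Algebra K L]
    [IsGalois K L] [FiniteDimensional K L] {p : ℕ} [Fact p.Prime] [CharP L p]
    (hdeg : Module.finrank K L = p) {s : L} (htr : Algebra.trace K L s = 1) :
    ∃ n : (L ≃ₐ[K] L) → ℕ,
      (∃ a : K, (∑ σ, n σ * σ s) ^ p - ∑ σ, n σ * σ s = algebraMap K L a) ∧
      ∃ τ : L ≃ₐ[K] L, τ (∑ σ, n σ * σ s) ≠ ∑ σ, n σ * σ s := by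
  have hcard : Nat.card (L ≃ₐ[K] L) = p := by rw [IsGalois.card_aut_eq_finrank, hdeg]
  let e : (L ≃ₐ[K] L) ≃* Multiplicative (ZMod p) :=
    mulEquivOfPrimeCardEq hcard (Nat.card_zmod p)
  let φ : (L ≃ₐ[K] L) → ZMod p := fun σ ↦ (e σ).toAdd
  have hφ : ∀ σ τ, φ (σ * τ) = φ σ + φ τ := fun σ τ ↦ by simp [φ]
  let ι : ZMod p →+* L := ZMod.castHom dvd_rfl L
  have hι : ∀ σ, (((φ σ).val : ℕ) : L) = ι (φ σ) := fun σ ↦ by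
    rw [← map_natCast ι, ZMod.natCast_zmod_val]
  -- Natural-number coefficients ensure that a denominator from `A` clearing `s` also clears `x`.
  set x : L := ∑ σ : L ≃ₐ[K] L, ((φ σ).val : L) * σ s with hx
  have hτ : ∀ τ : L ≃ₐ[K] L, τ x = x - ι (φ τ) := by
    intro τ
    have htr' : ∑ σ : L ≃ₐ[K] L, σ s = 1 := by
      rw [← trace_eq_sum_automorphisms, htr, map_one]
    calc τ x = ∑ σ : L ≃ₐ[K] L, ι (φ σ) * (τ * σ) s := by
          rw [hx, map_sum]
          refine Finset.sum_congr rfl fun σ _ ↦ ?_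
          rw [map_mul, map_natCast, hι, AlgEquiv.mul_apply]
      _ = ∑ σ : L ≃ₐ[K] L, (ι (φ (τ * σ)) - ι (φ τ)) * (τ * σ) s := by
          refine Finset.sum_congr rfl fun σ _ ↦ ?_
          rw [hφ, map_add, add_sub_cancel_left]
      _ = ∑ σ : L ≃ₐ[K] L, (ι (φ σ) - ι (φ τ)) * σ s :=
          Equiv.sum_comp (Equiv.mulLeft τ) fun σ ↦ (ι (φ σ) - ι (φ τ)) * σ s
      _ = x - ι (φ τ) := by
          simp only [sub_mul, Finset.sum_sub_distrib, ← Finset.mul_sum, htr', mul_one, hx, hι]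
  refine ⟨fun σ ↦ (φ σ).val, ?_, ?_⟩
  -- Each `τ` translates `x` by an element of the prime field, which Frobenius fixes.
  · have hfix : x ^ p - x ∈ (⊥ : IntermediateField K L) := by
      rw [IsGalois.mem_bot_iff_fixed]
      intro τ
      rw [map_sub, map_pow, hτ, sub_pow_char, ← map_pow, ZMod.pow_card]
      ring
    obtain ⟨a, ha⟩ := IntermediateField.mem_bot.mp hfix
    exact ⟨a, ha.symm⟩
  · refine ⟨e.symm (Multiplicative.ofAdd 1), fun h ↦ ?_⟩
    have h1 := hτ (e.symm (Multiplicative.ofAdd 1))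
    have h2 : φ (e.symm (Multiplicative.ofAdd 1)) = 1 := by simp [φ]
    rw [hx, h, h2, map_one, eq_comm, sub_eq_self] at h1
    exact one_ne_zero h1

theorem adjoin_simple_eq_top_of_ne {K L : Type*} [Field K] [Field L] [Algebra K L]
    (hdeg : (Module.finrank K L).Prime) {x : L} {τ : L ≃ₐ[K] L} (hτ : τ x ≠ x) :
    IntermediateField.adjoin K {x} = ⊤ := by
  have := IntermediateField.isSimpleOrder_of_finrank_prime K L hdeg
  refine (eq_bot_or_eq_top _).resolve_left fun h ↦ hτ ?_
  obtain ⟨a, rfl⟩ := IntermediateField.mem_bot.mp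
    (h ▸ IntermediateField.mem_adjoin_simple_self K x)
  exact τ.commutes a

theorem eq_one_of_smul_integralClosure {A K L : Type*} [CommRing A] [IsDomain A] [Field K]
    [Algebra A K] [IsFractionRing A K] [Field L] [Algebra K L] [Algebra A L]
    [IsScalarTower A K L] [FiniteDimensional K L] {σ : L ≃ₐ[K] L}
    (hσ : ∀ b : integralClosure A L, σ • b = b) : σ = 1 := by
  ext z
  have := integralClosure.isFractionRing_of_finite_extension (A := A) K L
  obtain ⟨b, c, -, rfl⟩ := IsFractionRing.div_surjective (integralClosure A L) z
  have h : ∀ b : integralClosure A L, σ (algebraMap _ L b) = algebraMap _ L b := fun b ↦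
    congrArg Subtype.val (hσ b)
  rw [map_div₀, h, h, AlgEquiv.one_apply]

/-! ### The trace ideal and the branch locus. -/

section Trace

variable {A K L : Type*} [CommRing A] [IsIntegrallyClosed A] [Field K] [Algebra A K]
  [IsFractionRing A K] [Field L] [Algebra K L] [Algebra A L] [IsScalarTower A K L]
  [FiniteDimensional K L] [IsGalois K L]

/-- The trace ideal of the integral closure of `A` in `L` avoids every prime of `A` over which
some prime has trivial inertia group. -/
theorem exists_trace_notMem {P : Ideal A} {q : Ideal (integralClosure A L)} [q.IsPrime]
    [hqP : q.LiesOver P] (hq : ∀ σ ∈ q.inertia (L ≃ₐ[K] L), σ = 1) :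
    ∃ b : integralClosure A L, ∃ a : A, algebraMap A K a = Algebra.trace K L b ∧ a ∉ P := by
  obtain ⟨b, hb⟩ := exists_sum_smul_notMem hq
  obtain ⟨a, ha⟩ := IsIntegrallyClosed.isIntegral_iff.mp
    (Algebra.isIntegral_trace (L := K) (F := L) (show IsIntegral A (b : L) from b.2))
  refine ⟨b, a, ha, fun haP ↦ hb ?_⟩
  rw [hqP.over, Ideal.mem_comap] at haP
  convert haP
  apply Subtype.ext
  change _ = algebraMap A L a
  rw [IsScalarTower.algebraMap_apply A K L, ha, trace_eq_sum_automorphisms,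
    AddSubmonoidClass.coe_finsetSum]
  rfl

/-- If `f` lies in the maximal ideal and in all primes of dimension one that are ramified in `L`,
then a power of `f` is a trace of an integral element. -/
theorem exists_trace_eq_pow [IsDomain A] [IsLocalRing A] [IsNoetherianRing A] (hdim : ringKrullDim A = 2)
    {f : A} (hf : f ∈ maximalIdeal A) (hfP : ∀ P ∈ branchPrimes A L, f ∈ P.asIdeal) :
    ∃ (k : ℕ) (b : L), IsIntegral A b ∧ Algebra.trace K L b = algebraMap A K (f ^ k) := by
  set B := integralClosure A L
  have : Module.Finite A B := IsIntegralClosure.finite A K L B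
  have : IsNoetherianRing B := IsNoetherianRing.of_finite A B
  have : FaithfulSMul A B := by
    rw [faithfulSMul_iff_algebraMap_injective]
    intro a b hab
    have := congrArg (algebraMap B L) hab
    rw [← IsScalarTower.algebraMap_apply, ← IsScalarTower.algebraMap_apply,
      IsScalarTower.algebraMap_apply A K L, IsScalarTower.algebraMap_apply A K L] at this
    exact IsFractionRing.injective A K ((algebraMap K L).injective this)
  let I : Ideal A :=
    { carrier := {a | ∃ b : B, algebraMap A K a = Algebra.trace K L b}
      zero_mem' := ⟨0, by simp⟩
      add_mem' := by
        rintro a a' ⟨b, hb⟩ ⟨b', hb'⟩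
        exact ⟨b + b', by rw [map_add, hb, hb', ← map_add]; rfl⟩
      smul_mem' := by
        rintro c a ⟨b, hb⟩
        refine ⟨c • b, ?_⟩
        rw [smul_eq_mul, map_mul, hb, ← smul_eq_mul, ← map_smul, algebraMap_smul]
        rfl }
  -- A prime `J` containing the trace ideal `I` but not `f` would have nontrivial inertia above it.
  -- It is neither maximal nor a branch prime, as those contain `f`; at the zero ideal and at
  -- unramified primes inertia is trivial.
  have hI : f ∈ I.radical := by
    rw [Ideal.radical_eq_sInf, Submodule.mem_sInf]
    rintro J ⟨hIJ, hJ⟩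
    by_contra hfJ
    have hnot : ∀ q : Ideal B, q.IsPrime → q.LiesOver J →
        ∃ σ ∈ q.inertia (L ≃ₐ[K] L), σ ≠ 1 := by
      intro q _ _
      by_contra! h
      obtain ⟨b, a, ha, haJ⟩ := exists_trace_notMem (P := J) h
      exact haJ (hIJ ⟨b, ha⟩)
    obtain ⟨q, hq, hqJ⟩ := Ideal.nonempty_primesOver (S := B) (P := J)
    by_cases hJ0 : J = ⊥
    · obtain ⟨σ, hσ, hσ1⟩ := hnot q hq hqJ
      have hq0 : q = ⊥ := by
        subst hJ0
        exact Ideal.eq_bot_of_liesOver_bot A q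
      rw [hq0] at hσ
      exact hσ1 (eq_one_of_smul_integralClosure (A := A) fun b ↦ sub_eq_zero.mp (hσ b))
    · have hJm : J ≠ maximalIdeal A := fun h ↦ hfJ (h ▸ hf)
      have hJ1 := mem_specOne_of_ne hdim ⟨J, hJ⟩ hJ0 hJm
      have hunr : Algebra.IsUnramifiedIn B J := by
        by_contra h
        exact hfJ (hfP ⟨J, hJ⟩ ⟨hJ1, h⟩)
      obtain ⟨σ, hσ, hσ1⟩ := hnot q hq hqJ
      have := hunr q hq hqJ
      exact hσ1 (eq_one_of_smul_integralClosure (A := A)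
        (smul_eq_of_mem_inertia_of_isUnramifiedAt (A := A) hσ))
  obtain ⟨k, b, hb⟩ := hI
  exact ⟨k, b, b.2, hb.symm⟩

end Trace

end Existence

/-! ### Normalizing the poles -/

section Poles

open IsLocalRing

theorem finite_setOf_artinSchreier_eq {k : Type*} [Field k] {p : ℕ} (hp : 1 < p) (γ : k) :
    {β : k | β ^ p - β = γ}.Finite := by
  open Polynomial in
  have hmonic : (X ^ p - (X + C γ) : k[X]).Monic := by
    refine monic_X_pow_sub ?_
    rw [degree_X_add_C]
    exact_mod_cast hp
  refine (Polynomial.finite_setOfPred_isRoot hmonic.ne_zero).subset fun β hβ ↦ ?_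
  have : β ^ p - β = γ := hβ
  simp [← this]

/-- Adding `b ^ p - b` for a suitable `b ∈ A`, one may assume that `a` does not vanish along
finitely many given prime divisors. -/
theorem exists_artinSchreier_shift {A K ι : Type*} [CommRing A] [IsLocalRing A] [Field K]
    [Algebra A K] [FaithfulSMul A K] [Infinite (ResidueField A)] [Finite ι] {p : ℕ} (hp : 1 < p)
    {P : ι → PrimeSpectrum A} {t : ι → A} (ht : ∀ i, (P i).asIdeal = Ideal.span {t i}) (a : K) :
    ∃ b : A, ∀ i, ∀ u v : A, v ∉ (P i).asIdeal →
      (a + algebraMap A K (b ^ p - b)) * algebraMap A K v ≠ algebraMap A K (t i * u) := by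
  -- The bad residues for component `i`: the shifted element has positive order there or is zero.
  -- Two bad shifts differ by an element of `P i`, so all bad residues solve one Artin–Schreier
  -- equation.
  let S : ι → Set (ResidueField A) := fun i ↦ {β | ∃ b : A, residue A b = β ∧
    ∃ u v : A, v ∉ (P i).asIdeal ∧
      (a + algebraMap A K (b ^ p - b)) * algebraMap A K v = algebraMap A K (t i * u)}
  have hS : ∀ i, (S i).Finite := by
    intro i
    rcases (S i).eq_empty_or_nonempty with h | ⟨β, b, -, u, v, hv, hb⟩
    · rw [h]; exact Set.finite_empty
    refine (finite_setOf_artinSchreier_eq hp (residue A b ^ p - residue A b)).subset ?_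
    rintro _ ⟨b', rfl, u', v', hv', hb'⟩
    have h1 : ((b' ^ p - b') - (b ^ p - b)) * (v * v') = t i * (u' * v - u * v') := by
      apply FaithfulSMul.algebraMap_injective A K
      simp only [map_mul, map_sub, map_pow] at hb hb' ⊢
      linear_combination algebraMap A K v * hb' - algebraMap A K v' * hb
    have h2 : (b' ^ p - b') - (b ^ p - b) ∈ (P i).asIdeal := by
      refine ((P i).isPrime.mem_or_mem (?_ : _ * (v * v') ∈ _)).resolve_right fun h ↦
        ((P i).isPrime.mem_or_mem h).elim hv hv'
      rw [h1, ht i]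
      exact Ideal.mul_mem_right _ _ (Ideal.mem_span_singleton_self _)
    have h3 := (residue_eq_zero_iff _).mpr (le_maximalIdeal (P i).isPrime.ne_top h2)
    rw [map_sub, sub_eq_zero] at h3
    simpa using h3
  obtain ⟨β, hβ⟩ := (Set.finite_iUnion hS).infinite_compl.nonempty
  obtain ⟨b, rfl⟩ := residue_surjective β
  exact ⟨b, fun i u v hv h ↦ hβ (Set.mem_iUnion.mpr ⟨i, b, rfl, u, v, hv, h⟩)⟩

/-- The last hypothesis says that `a` is outside the maximal ideal of the localization at `P i`.
Hence `t i` divides the numerator `c` at most `k` times, and the pole order is the difference. -/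
theorem exists_hasOrderAt_neg {A K ι : Type*} [CommRing A] [IsDomain A]
    [UniqueFactorizationMonoid A] [Field K] [Algebra A K] [IsFractionRing A K]
    [Fintype ι] {P : ι → PrimeSpectrum A} {t : ι → A}
    (ht : ∀ i, (P i).asIdeal = Ideal.span {t i}) (ht0 : ∀ i, t i ≠ 0)
    (hP : Function.Injective P) {a : K} {k : ℕ} {c : A}
    (hc : a * algebraMap A K ((∏ i, t i) ^ k) = algebraMap A K c) (i : ι)
    (ha : ∀ u v : A, v ∉ (P i).asIdeal →
      a * algebraMap A K v ≠ algebraMap A K (t i * u)) :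
    ∃ m : ℕ, HasOrderAt (P i) a (-(m : ℤ)) := by
  classical
  have hinj := IsFractionRing.injective A K
  have hprime : ∀ i, Prime (t i) := fun i ↦
    (Ideal.span_singleton_prime (ht0 i)).mp (ht i ▸ (P i).isPrime)
  have htK : algebraMap A K (t i) ≠ 0 := (map_ne_zero_iff _ hinj).mpr (ht0 i)
  set h := ∏ j ∈ Finset.univ.erase i, t j
  have hth : ∏ j, t j = t i * h := (Finset.mul_prod_erase _ _ (Finset.mem_univ i)).symm
  have hh : h ^ k ∉ (P i).asIdeal := by
    intro hk
    have h1 := (P i).isPrime.mem_of_pow_mem _ hk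
    rw [ht i, Ideal.mem_span_singleton, (hprime i).dvd_finsetProd_iff] at h1
    obtain ⟨j, hj, hij⟩ := h1
    refine (Finset.ne_of_mem_erase hj) (hP ?_)
    ext1
    rw [ht, ht, Ideal.span_singleton_eq_span_singleton]
    exact ((hprime i).irreducible.associated_of_dvd (hprime j).irreducible hij).symm
  rw [hth, mul_pow, map_mul, map_pow] at hc
  have hc0 : c ≠ 0 := by
    rintro rfl
    rw [map_zero, mul_eq_zero, or_iff_left] at hc
    · exact ha 0 1 ((P i).asIdeal.ne_top_iff_one.mp (P i).isPrime.ne_top) (by simp [hc])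
    · refine mul_ne_zero (pow_ne_zero _ htK) ((map_ne_zero_iff _ hinj).mpr ?_)
      intro h0
      exact hh (h0 ▸ (P i).asIdeal.zero_mem)
  obtain ⟨e, c', hc', rfl⟩ := WfDvdMonoid.max_power_factor hc0 (hprime i).irreducible
  rw [map_mul, map_pow] at hc
  have hek : e ≤ k := by
    by_contra! hlt
    obtain ⟨l, rfl⟩ := Nat.exists_eq_add_of_lt hlt
    refine ha (t i ^ l * c') (h ^ k) hh ?_
    apply mul_left_cancel₀ (pow_ne_zero k htK)
    simp only [map_mul, map_pow] at hc ⊢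
    linear_combination hc
  obtain ⟨l, rfl⟩ := Nat.exists_eq_add_of_le hek
  refine ⟨l, t i, c', h ^ (e + l), ht i, ?_, hh, ?_⟩
  · rwa [ht i, Ideal.mem_span_singleton]
  · rw [zpow_neg, zpow_natCast]
    apply mul_left_cancel₀ (pow_ne_zero (e + l) htK)
    simp only [map_pow] at hc ⊢
    rw [mul_left_comm, ← mul_assoc] at hc
    rw [pow_add (algebraMap A K (t i)), mul_assoc _ _ (_⁻¹ * _),
      mul_inv_cancel_left₀ (pow_ne_zero _ htK), ← hc, pow_add (algebraMap A K (t i))]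
    ring

theorem mem_adjoin_of_mul_prod_pow_eq {A K ι : Type*} [CommRing A] [Field K] [Algebra A K]
    [Fintype ι] {t : ι → A} (ht : ∀ i, algebraMap A K (t i) ≠ 0) {a : K} {k : ℕ} {c : A}
    (hc : a * algebraMap A K ((∏ i, t i) ^ k) = algebraMap A K c) :
    a ∈ Algebra.adjoin A (Set.range fun i ↦ (algebraMap A K (t i))⁻¹) := by
  have h1 : a = algebraMap A K c * (∏ i, (algebraMap A K (t i))⁻¹) ^ k := by
    rw [← hc, map_pow, map_prod, Finset.prod_inv_distrib, inv_pow, mul_inv_cancel_right₀]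
    exact pow_ne_zero _ (Finset.prod_ne_zero_iff.mpr fun i _ ↦ ht i)
  rw [h1]
  exact Subalgebra.mul_mem _ (Subalgebra.algebraMap_mem _ c) (Subalgebra.pow_mem _
    (Subalgebra.prod_mem _ fun i _ ↦ Algebra.subset_adjoin (Set.mem_range_self i)) k)

theorem exists_isArtinSchreierGenerator {A K L : Type*} [CommRing A] [IsDomain A]
    [UniqueFactorizationMonoid A] [IsLocalRing A] [IsNoetherianRing A] (p : ℕ) [Fact p.Prime]
    [CharP A p] [Infinite (ResidueField A)] (hdim : ringKrullDim A = 2)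
    [Field K] [Algebra A K] [IsFractionRing A K]
    [Field L] [Algebra K L] [Algebra A L] [IsScalarTower A K L] [IsGalois K L]
    (hdeg : Module.finrank K L = p) {d : ℕ} (hd : 1 ≤ d) {P : Fin d → PrimeSpectrum A}
    (hP : Function.Injective P) (hPL : Set.range P = branchPrimes A L) {t : Fin d → A}
    (ht : ∀ i, (P i).asIdeal = Ideal.span {t i}) (ht0 : ∀ i, t i ≠ 0) :
    ∃ (x : L) (a : K) (m : Fin d → ℕ), IsArtinSchreierGenerator p P x a m := by
  have hp := (Fact.out : p.Prime)
  have hinj := IsFractionRing.injective A K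
  have : FiniteDimensional K L := Module.finite_of_finrank_pos (hdeg ▸ hp.pos)
  have : CharP K p := charP_of_injective_algebraMap hinj p
  have : CharP L p := charP_of_injective_algebraMap (algebraMap K L).injective p
  have htK : ∀ i, algebraMap A K (t i) ≠ 0 := fun i ↦ (map_ne_zero_iff _ hinj).mpr (ht0 i)
  set f := ∏ i, t i with hf
  have hfP : ∀ i, f ∈ (P i).asIdeal := fun i ↦ by
    rw [ht i, Ideal.mem_span_singleton]
    exact Finset.dvd_prod_of_mem t (Finset.mem_univ i)
  have hfK : algebraMap A K f ≠ 0 :=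
    (map_ne_zero_iff _ hinj).mpr (Finset.prod_ne_zero_iff.mpr fun i _ ↦ ht0 i)
  -- Non-emptiness of the branch locus puts `f` in the maximal ideal.
  obtain ⟨k, b, hb, htr⟩ := exists_trace_eq_pow (K := K) (L := L) hdim
    (le_maximalIdeal (P ⟨0, hd⟩).isPrime.ne_top (hfP ⟨0, hd⟩)) (fun Q hQ ↦ by
      rw [← hPL] at hQ
      obtain ⟨i, rfl⟩ := hQ
      exact hfP i)
  set F := algebraMap A K (f ^ k) with hF
  have hF0 : F ≠ 0 := by rw [hF, map_pow]; exact pow_ne_zero _ hfK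
  obtain ⟨n, ⟨a, ha⟩, τ, hτ⟩ := exists_artinSchreier_generator hdeg (s := F⁻¹ • b)
    (by rw [map_smul, htr, smul_eq_mul, inv_mul_cancel₀ hF0])
  set x := ∑ σ : L ≃ₐ[K] L, (n σ : L) * σ (F⁻¹ • b) with hx
  have hxint : IsIntegral A (algebraMap A L (f ^ k) * x) := by
    rw [hx, Finset.mul_sum]
    refine IsIntegral.sum _ fun σ _ ↦ ?_
    have h1 : algebraMap A L (f ^ k) * (n σ * σ (F⁻¹ • b)) = n σ * σ b := by
      rw [map_smul, Algebra.smul_def, map_inv₀, hF, ← IsScalarTower.algebraMap_apply,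
        mul_left_comm, mul_inv_cancel_left₀]
      rwa [IsScalarTower.algebraMap_apply A K L, Ne, map_eq_zero]
    rw [h1]
    have h2 : IsIntegral A (n σ : L) := by
      simpa using isIntegral_algebraMap (R := A) (A := L) (x := (n σ : A))
    exact h2.mul (hb.map (σ.toAlgHom.restrictScalars A))
  -- Since `f ^ k` clears `x`, its `p`-th power clears `x ^ p - x`; an integral element of `K` lies
  -- in `A`.
  obtain ⟨c, hc⟩ : ∃ c : A, a * algebraMap A K (f ^ (k * p)) = algebraMap A K c := by
    have h1 : IsIntegral A (algebraMap K L (a * algebraMap A K (f ^ (k * p)))) := by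
      have h2 : algebraMap K L (a * algebraMap A K (f ^ (k * p))) =
          (algebraMap A L (f ^ k) * x) ^ p -
            algebraMap A L ((f ^ k) ^ (p - 1)) * (algebraMap A L (f ^ k) * x) := by
        have h3 : algebraMap A L (f ^ k) ^ p =
            algebraMap A L (f ^ k) ^ (p - 1) * algebraMap A L (f ^ k) := by
          rw [← pow_succ, Nat.sub_add_cancel hp.one_le]
        rw [map_mul, ← ha, ← IsScalarTower.algebraMap_apply, pow_mul, mul_pow,
          map_pow _ (f ^ k) p, map_pow _ (f ^ k) (p - 1)]
        linear_combination (-x) * h3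
      rw [h2]
      exact (hxint.pow p).sub (isIntegral_algebraMap.mul hxint)
    obtain ⟨c, hc⟩ := IsIntegrallyClosed.isIntegral_iff.mp
      ((isIntegral_algebraMap_iff (algebraMap K L).injective).mp h1)
    exact ⟨c, hc.symm⟩
  -- Replacing `x` by `x + β` removes zeros of `a` along the branch components without creating
  -- other poles.
  obtain ⟨β, hβ⟩ := exists_artinSchreier_shift (K := K) hp.one_lt ht a
  set a' := a + algebraMap A K (β ^ p - β) with ha'
  have hc' : a' * algebraMap A K (f ^ (k * p)) =
      algebraMap A K (c + (β ^ p - β) * f ^ (k * p)) := by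
    rw [ha', add_mul, hc, map_add, map_mul]
  choose m hm using fun i ↦ exists_hasOrderAt_neg ht ht0 hP hc' i (hβ i)
  refine ⟨x + algebraMap A L β, a', m, ?_, ?_, ⟨t, ht, mem_adjoin_of_mul_prod_pow_eq htK hc'⟩, hm⟩
  · rw [add_pow_char, ha', map_add, ← ha, ← IsScalarTower.algebraMap_apply, map_sub, map_pow]
    ring
  · refine adjoin_simple_eq_top_of_ne (τ := τ) (hdeg ▸ hp) fun h ↦ hτ ?_
    rw [map_add, IsScalarTower.algebraMap_apply A K L, τ.commutes] at h
    exact add_right_cancel h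

end Poles

/-! ### Finiteness of the jumps and the explicit bound. -/

theorem theorem3 {A K L : Type*} [CommRing A] [IsRegularLocalRing A]
    (p : ℕ) [Fact p.Prime] [CharP A p] [IsAlgClosed (IsLocalRing.ResidueField A)]
    (hdim : ringKrullDim A = 2)
    [Field K] [Algebra A K] [IsFractionRing A K]
    [Field L] [Algebra K L] [Algebra A L] [IsScalarTower A K L]
    [IsGalois K L] [IsCyclic (L ≃ₐ[K] L)] (hdeg : Module.finrank K L = p)
    {d : ℕ} (P : Fin d → PrimeSpectrum A) (hP : IsNormalCrossingBranch L P) :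
    (∀ r : ℕ, 1 ≤ r → genericJump L p P r < ⊤) ∧
    (∃ (x : L) (a : K) (m : Fin d → ℕ), IsArtinSchreierGenerator p P x a m) ∧
    ∀ (x : L) (a : K) (m : Fin d → ℕ), IsArtinSchreierGenerator p P x a m →
      ∀ r : ℕ, 1 ≤ r →
        genericJump L p P r ≤
          ((∑ i : Fin d, (if i.val = 0 then r else 1) * m i : ℕ) : ℕ∞) := by
  have : IsDomain A := (IsFractionRing.injective A K).isDomain (algebraMap A K)
  have hP1 : ∀ i, ringKrullDim (A ⧸ (P i).asIdeal) = 1 := fun i ↦ by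
    have h : P i ∈ branchPrimes A L := hP.range_eq ▸ Set.mem_range_self i
    exact h.1
  have := hP.regular
  choose t ht using fun i ↦ IsRegularLocalRing.exists_eq_span_singleton hdim (hP1 i)
  have ht0 : ∀ i, t i ≠ 0 := by
    intro i h
    have h1 := hP1 i
    rw [ht i, h, Ideal.span_singleton_eq_bot.mpr rfl,
      ringKrullDim_eq_of_ringEquiv (RingEquiv.quotientBot A), hdim] at h1
    exact absurd h1 (by decide)
  have hP0 : ∀ i, (P i).asIdeal ≠ ⊥ := fun i h ↦
    ht0 i (Ideal.span_singleton_eq_bot.mp ((ht i).symm.trans h))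
  -- Factoriality needs only one prime element with principal quotient, and the first branch
  -- component supplies it.
  have hUFD : UniqueFactorizationMonoid A := by
    have := IsRegularLocalRing.isDiscreteValuationRing (hP1 ⟨0, hP.one_le⟩)
    have h1 : IsPrincipalIdealRing (A ⧸ (P ⟨0, hP.one_le⟩).asIdeal) := inferInstance
    rw [ht] at h1
    exact .of_isPrincipalIdealRing_quotient ((Ideal.span_singleton_prime (ht0 _)).mp
      (ht ⟨0, hP.one_le⟩ ▸ (P ⟨0, hP.one_le⟩).isPrime))
  have hbound := fun (x : L) (a : K) (m : Fin d → ℕ) (h : IsArtinSchreierGenerator p P x a m)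
    (r : ℕ) ↦ genericJump_le hdeg hP.injective hP0 h r
  have hex : ∃ (x : L) (a : K) (m : Fin d → ℕ), IsArtinSchreierGenerator p P x a m :=
    exists_isArtinSchreierGenerator p hdim hdeg hP.one_le hP.injective hP.range_eq ht ht0
  refine ⟨fun r _ ↦ ?_, hex, fun x a m h r _ ↦ hbound x a m h r⟩
  obtain ⟨x, a, m, h⟩ := hex
  exact (hbound x a m h r).trans_lt (ENat.natCast_lt_top _)
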